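/- A hypergraph is \emph{$r$-partite} if its vertex set can be partitioned into $r$ sides $V_1,\dots,V_r$ so that every edge contains exactly one vertex from each side. The covering number $\tau(H)$ is the least size of a set of vertices meeting every edge of $H$, the matching number $\nu(H)$ is the largest number of pairwise disjoint edges of $H$, and $H$ is \emph{intersecting} if $\nu(H)=1$. Let $f(r)$ be the smallest integer $k$ for which there exists an intersecting $r$-partite hypergraph $H$ with exactly $k$ edges and $\tau(H)\ge r-1$ (if there is any such $H$ with finitely many edges). **Theorem.** $f(7)$ is defined and $f(7)=17$; that is, there is an intersecting $7$-partite hypergraph with $17$ edges and covering number at least $6$, and every intersecting $7$-partite hypergraph with covering number at least $6$ has at least $17$ edges. Moreover, let $H_0$ be the hypergraph with vertices $(i,a)$, $1\le i\le 7$, $1\le a\le 6$, sides $V_i=\{(i,a):1\le a\le 6\}$, and the following edges, where a sequence $a_1a_2\cdots a_7$ denotes the edge $\{(i,a_i):1\le i\le 7\}$: $$ \begin{array}{lllll} 1111111& 1235354& 2313664& 4412343& 6142564\\ 2154322& 1344433& 3514555& 4551234& \\ 3332221& 1424266& 3655163& 5123253& \\ 4325512& 2222135& 4136465& 5361365& \end{array}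 $$ Then $H_0$ is an intersecting $7$-partite hypergraph with exactly $17$ edges and $\tau(H_0)=6$. In particular $\tau(H_0)=(7-1)\,\nu(H_0)$, so Ryser's bound $\tau\le(r-1)\nu$ for $r$-partite hypergraphs is attained for $r=7$. -/

import Mathlib

open scoped Hypergraph

universe u

namespace Hypergraph

variable {α : Type u}

/-- `H` is `r`-partite: its vertex set can be partitioned into `r` sides so that every edge
contains precisely one vertex from each side. -/
def IsPartite (H : Hypergraph α) (r : ℕ) : Prop :=
  ∃ side : Fin r → Set α,
    Pairwise (fun i j => Disjoint (side i) (side j)) ∧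
    (⋃ i, side i) = V(H) ∧
    ∀ e ∈ E(H), ∀ i, ∃! x, x ∈ e ∩ side i

/-- A cover of `H`: a set of vertices meeting every edge. -/
def IsCover (H : Hypergraph α) (C : Set α) : Prop :=
  C ⊆ V(H) ∧ ∀ e ∈ E(H), (C ∩ e).Nonempty

/-- The covering number `τ(H)`: the least size of a cover of `H`. -/
noncomputable def coveringNumber (H : Hypergraph α) : ℕ∞ :=
  ⨅ (C : Set α) (_ : H.IsCover C), C.encard

/-- A matching of `H`: a set of pairwise disjoint edges. -/
def IsMatching (H : Hypergraph α) (M : Set (Set α)) : Prop :=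
  M ⊆ E(H) ∧ M.Pairwise Disjoint

/-- The matching number `ν(H)`: the largest size of a matching in `H`. -/
noncomputable def matchingNumber (H : Hypergraph α) : ℕ∞ :=
  ⨆ (M : Set (Set α)) (_ : H.IsMatching M), M.encard

/-- `H` is intersecting if its matching number is `1`. -/
def IsIntersecting (H : Hypergraph α) : Prop :=
  H.matchingNumber = 1

end Hypergraph

/-- Each row describes one edge of the hypergraph `tightHypergraph`: the entry in column `i`
is the vertex that the edge takes in the `i`-th side. -/
def tightRows : Fin 17 → Fin 7 → ℕ :=
  ![![1, 1, 1, 1, 1, 1, 1],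
    ![2, 1, 5, 4, 3, 2, 2],
    ![3, 3, 3, 2, 2, 2, 1],
    ![4, 3, 2, 5, 5, 1, 2],
    ![1, 2, 3, 5, 3, 5, 4],
    ![1, 3, 4, 4, 4, 3, 3],
    ![1, 4, 2, 4, 2, 6, 6],
    ![2, 2, 2, 2, 1, 3, 5],
    ![2, 3, 1, 3, 6, 6, 4],
    ![3, 5, 1, 4, 5, 5, 5],
    ![3, 6, 5, 5, 1, 6, 3],
    ![4, 1, 3, 6, 4, 6, 5],
    ![4, 4, 1, 2, 3, 4, 3],
    ![4, 5, 5, 1, 2, 3, 4],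
    ![5, 1, 2, 3, 2, 5, 3],
    ![5, 3, 6, 1, 3, 6, 5],
    ![6, 1, 4, 2, 5, 6, 4]]

/-- The hypergraph with vertices `(i, a)`, where `i` is one of `7` sides and `1 ≤ a ≤ 6`,
whose edges are described by the rows of `tightRows`. -/
def tightHypergraph : Hypergraph (Fin 7 × ℕ) where
  vertexSet := {v | 1 ≤ v.2 ∧ v.2 ≤ 6}
  edgeSet := Set.range fun j : Fin 17 => Set.range fun i : Fin 7 => (i, tightRows j i)
  subset_vertexSet_of_mem_edgeSet' := by
    have h : ∀ (j : Fin 17) (i : Fin 7), 1 ≤ tightRows j i ∧ tightRows j i ≤ 6 := by decide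
    rintro _ ⟨j, rfl⟩ _ ⟨i, rfl⟩
    exact h j i

set_option linter.unusedSectionVars false

/-! ### Covers by classes of seven partitions -/

namespace PartitionCover

open Finset

variable {X β : Type*} [DecidableEq X] [DecidableEq β]

/-! Lower bound. List the edges as 16 points, repeating some if there are fewer, and let each side
partition them by the vertex they use there. Intersecting edges become points that share a class on
some side, and a vertex cover becomes a family of classes covering all points. `exists_cov_five`
shows that five classes suffice.

Suppose they do not. Leftover points can be covered two at a time, and ten points need only four
classes (`cov_four_of_card_le_ten`). Hence no block has more than 5 points, and disjoint blocks of
sizes 5,5 or 5,4,3 or 5,3,3,3 cannot exist. Counting how many of the 120 pairs each side can join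
forces a 5-block, and then a 5-block F disjoint from a 4-block D (`exists_disjoint_five_four`).

Let E be the remaining seven points. Every class meets E in at most two points, so the 21 pairs of E
are split exactly, three per side. A point of D sharing a class with a pair of E forms a 3-block
with it. Bounding the contacts between E and the rest (`contact_sum_le`) gives the four points of D
matchings of at least 3, 3, 3 and 2 such pairs. These matchings have no common pair, since that
would produce blocks 5,4,3. A finite check in the complete graph on seven vertices
(`exists_rainbow`) finds three disjoint pairs belonging to three different points of D, which gives
blocks 5,3,3,3, a contradiction.

Upper bound. The 17 rows are checked by computation, with an exhaustive branching search excluding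
covers of size five. -/

/-- `S` is covered by at most `k` classes of the partitions given by the fibres of the `ℓ s`. -/
def Cov (ℓ : Fin 7 → X → β) (k : ℕ) (S : Finset X) : Prop :=
  ∃ c : Finset (Fin 7 × β), #c ≤ k ∧ ∀ x ∈ S, ∃ p ∈ c, ℓ p.1 x = p.2

/-- `B` lies in a class of one of the partitions. -/
def IsBlock (ℓ : Fin 7 → X → β) (B : Finset X) : Prop :=
  ∃ s v, ∀ x ∈ B, ℓ s x = v

variable {ℓ : Fin 7 → X → β}

lemma Cov.mono {k m : ℕ} {S T : Finset X} (h : Cov ℓ k S) (hk : k ≤ m) (hT : T ⊆ S) :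
    Cov ℓ m T := by
  obtain ⟨c, hc, h⟩ := h
  exact ⟨c, hc.trans hk, fun x hx => h x (hT hx)⟩

lemma Cov.union {k m : ℕ} {S T : Finset X} (h : Cov ℓ k S) (h' : Cov ℓ m T) :
    Cov ℓ (k + m) (S ∪ T) := by
  obtain ⟨c, hc, h⟩ := h
  obtain ⟨d, hd, h'⟩ := h'
  refine ⟨c ∪ d, (card_union_le _ _).trans (by omega), fun x hx => ?_⟩
  rcases mem_union.1 hx with hx | hx
  · obtain ⟨p, hp, e⟩ := h x hx
    exact ⟨p, mem_union_left _ hp, e⟩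
  · obtain ⟨p, hp, e⟩ := h' x hx
    exact ⟨p, mem_union_right _ hp, e⟩

lemma IsBlock.cov {B : Finset X} (h : IsBlock ℓ B) : Cov ℓ 1 B := by
  obtain ⟨s, v, h⟩ := h
  exact ⟨{(s, v)}, by simp, fun x hx => ⟨(s, v), by simp, h x hx⟩⟩

lemma IsBlock.mono {B T : Finset X} (h : IsBlock ℓ B) (hT : T ⊆ B) : IsBlock ℓ T := by
  obtain ⟨s, v, h⟩ := h
  exact ⟨s, v, fun x hx => h x (hT hx)⟩

lemma cov_of_image {S : Finset X} (s : Fin 7) (V : Finset β) (h : ∀ x ∈ S, ℓ s x ∈ V) :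
    Cov ℓ #V S :=
  ⟨V.image fun v => (s, v), card_image_le, fun x hx =>
    ⟨(s, ℓ s x), mem_image_of_mem _ (h x hx), rfl⟩⟩

/-- Any two points share a class, so the points can be removed in pairs, one class per pair. -/
lemma cov_of_card_le (hℓ : ∀ x y, ∃ s, ℓ s x = ℓ s y) (k : ℕ) (S : Finset X) (h : #S ≤ 2 * k) :
    Cov ℓ k S := by
  induction k generalizing S with
  | zero =>
    have : S = ∅ := by simpa using h
    exact ⟨∅, by simp, by simp [this]⟩
  | succ k ih =>
    by_cases h2 : ∃ x ∈ S, ∃ y ∈ S, x ≠ y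
    · obtain ⟨x, hx, y, hy, hxy⟩ := h2
      obtain ⟨s, hs⟩ := hℓ x y
      have hb : IsBlock ℓ {x, y} := ⟨s, ℓ s y, by simp [hs]⟩
      have hsub : {x, y} ⊆ S := by simp [insert_subset_iff, hx, hy]
      have hc := card_sdiff_add_card_eq_card hsub
      rw [card_pair hxy] at hc
      have := (ih (S \ {x, y}) (by omega)).union hb.cov
      rwa [sdiff_union_of_subset hsub] at this
    · push Not at h2
      rcases S.eq_empty_or_nonempty with rfl | ⟨x, hx⟩
      · exact ⟨∅, by simp, by simp⟩
      · obtain ⟨s⟩ : Nonempty (Fin 7) := inferInstance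
        exact ⟨{(s, ℓ s x)}, by simp, fun y hy => ⟨(s, ℓ s x), by simp, by rw [h2 x hx y hy]⟩⟩

lemma Cov.extend (hℓ : ∀ x y, ∃ s, ℓ s x = ℓ s y) {k : ℕ} (m : ℕ) {S T : Finset X}
    (h : Cov ℓ k S) (hT : #(T \ S) ≤ 2 * m) : Cov ℓ (k + m) T :=
  (h.union (cov_of_card_le hℓ m _ hT)).mono le_rfl (by simp)

/-! ### Counting pairs inside classes -/

/-- The number of classes of `f` that contain at least `k` points of `S`. -/
def numClasses (f : X → β) (S : Finset X) (k : ℕ) : ℕ :=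
  #{v ∈ S.image f | k ≤ #{x ∈ S | f x = v}}

/-- The ordered pairs of distinct points of `S` in a common class of `f`. -/
def samePairs (f : X → β) (S : Finset X) : Finset (X × X) :=
  {p ∈ S.offDiag | f p.1 = f p.2}

lemma numClasses_anti (f : X → β) (S : Finset X) {k m : ℕ} (h : k ≤ m) :
    numClasses f S m ≤ numClasses f S k :=
  card_le_card (monotone_filter_right _ fun _ _ hv => h.trans hv)

lemma numClasses_one (f : X → β) (S : Finset X) : numClasses f S 1 = #(S.image f) := by
  rw [numClasses, filter_true_of_mem]
  intro v hv
  obtain ⟨x, hx, rfl⟩ := mem_image.1 hv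
  exact card_pos.2 ⟨x, by simp [hx]⟩

lemma numClasses_eq_sum (f : X → β) (S : Finset X) (k : ℕ) :
    numClasses f S k = ∑ v ∈ S.image f, if k ≤ #{x ∈ S | f x = v} then 1 else 0 :=
  card_filter _ _

lemma card_samePairs_sum (f : X → β) (S : Finset X) :
    #(samePairs f S) = ∑ v ∈ S.image f, (#{x ∈ S | f x = v} * #{x ∈ S | f x = v}
      - #{x ∈ S | f x = v}) := by
  rw [card_eq_sum_card_fiberwise (f := fun p => f p.1) (t := S.image f)]
  · refine sum_congr rfl fun v _ => ?_
    rw [← offDiag_card]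
    congr 1
    ext ⟨x, y⟩
    simp only [samePairs, mem_filter, mem_offDiag]
    grind
  · intro p hp
    simp only [samePairs, coe_filter, mem_offDiag, Set.mem_ofPred_eq] at hp
    simpa using ⟨p.1, hp.1.1, rfl⟩

/-- A class of size `n` is counted once by each of the thresholds `1, …, n`; this is the conjugate
partition. In the same way `n * n - n` is the sum of `2 * (k - 1)` over `k ≤ n`, which gives the
pair count in `card_samePairs_eq`. All later size constraints thus become linear. -/
lemma card_eq_numClasses (f : X → β) (S : Finset X) (h : ∀ v, #{x ∈ S | f x = v} ≤ 5) :
    #S = numClasses f S 1 + numClasses f S 2 + numClasses f S 3 + numClasses f S 4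
      + numClasses f S 5 := by
  simp only [numClasses_eq_sum, ← sum_add_distrib]
  rw [card_eq_sum_card_image f]
  refine sum_congr rfl fun v _ => ?_
  have := h v
  generalize #{x ∈ S | f x = v} = n at *
  interval_cases n <;> simp

lemma card_samePairs_eq (f : X → β) (S : Finset X) (h : ∀ v, #{x ∈ S | f x = v} ≤ 5) :
    #(samePairs f S) = 2 * numClasses f S 2 + 4 * numClasses f S 3 + 6 * numClasses f S 4
      + 8 * numClasses f S 5 := by
  rw [card_samePairs_sum]
  simp only [numClasses_eq_sum, mul_sum, ← sum_add_distrib]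
  refine sum_congr rfl fun v _ => ?_
  have := h v
  generalize #{x ∈ S | f x = v} = n at *
  interval_cases n <;> simp

lemma numClasses_eq_zero (f : X → β) (S : Finset X) {k m : ℕ} (h : ∀ v, #{x ∈ S | f x = v} ≤ m)
    (hk : m < k) : numClasses f S k = 0 := by
  rw [numClasses, card_eq_zero, filter_eq_empty_iff]
  intro v _
  have := h v
  omega

lemma card_le_sum_pairs {P : Finset (X × X)} (hP : ∀ p ∈ P, ∃ s, ℓ s p.1 = ℓ s p.2) :
    #P ≤ ∑ s, #{p ∈ P | ℓ s p.1 = ℓ s p.2} := by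
  have h : P ⊆ univ.biUnion fun s => {p ∈ P | ℓ s p.1 = ℓ s p.2} := by
    intro p hp
    obtain ⟨s, hs⟩ := hP p hp
    simpa using ⟨hp, s, hs⟩
  exact (card_le_card h).trans card_biUnion_le

lemma card_offDiag_le (hℓ : ∀ x y, ∃ s, ℓ s x = ℓ s y) (S : Finset X) :
    #S * #S - #S ≤ ∑ s, #(samePairs (ℓ s) S) := by
  rw [← offDiag_card]
  exact card_le_sum_pairs fun p _ => hℓ _ _

/-- Equality case of the union bound: every pair is joined on at least one side, so if the total
does not exceed the number of pairs, each is joined exactly once. -/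
lemma side_unique_of_sum_le {P : Finset (X × X)} (hP : ∀ p ∈ P, ∃ s, ℓ s p.1 = ℓ s p.2)
    (hsum : ∑ s, #{p ∈ P | ℓ s p.1 = ℓ s p.2} ≤ #P) {p : X × X} (hp : p ∈ P) {s t : Fin 7}
    (hs : ℓ s p.1 = ℓ s p.2) (ht : ℓ t p.1 = ℓ t p.2) : s = t := by
  have h1 : ∀ q ∈ P, 1 ≤ #{s | ℓ s q.1 = ℓ s q.2} := fun q hq =>
    let ⟨s, hs⟩ := hP q hq
    card_pos.2 ⟨s, by simpa using hs⟩
  have h2 : ∑ q ∈ P, #{s | ℓ s q.1 = ℓ s q.2} = ∑ s, #{p ∈ P | ℓ s p.1 = ℓ s p.2} := by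
    simp only [card_filter]
    rw [sum_comm]
  have h3 : ∑ q ∈ P, 1 = ∑ q ∈ P, #{s | ℓ s q.1 = ℓ s q.2} :=
    le_antisymm (sum_le_sum h1) (by rw [h2]; simpa using hsum)
  have h4 := (sum_eq_sum_iff_of_le h1).1 h3 p hp
  exact card_le_one.1 h4.ge _ (by simpa using hs) _ (by simpa using ht)

end PartitionCover

/-! ### Small covers and forbidden configurations of blocks -/

namespace PartitionCover

open Finset

variable {X β : Type*} [DecidableEq X] [DecidableEq β] {ℓ : Fin 7 → X → β}

lemma card_filter_mem (f : X → β) (T : Finset X) (V : Finset β) :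
    #{x ∈ T | f x ∈ V} = ∑ v ∈ V, #{x ∈ T | f x = v} := by
  rw [card_eq_sum_card_fiberwise (f := f) (t := V) (by intro x hx; simp_all)]
  refine sum_congr rfl fun v hv => ?_
  rw [filter_filter]
  congr 1
  ext x
  simp only [mem_filter]
  grind

lemma card_lt_of_not_cov (hℓ : ∀ x y, ∃ s, ℓ s x = ℓ s y) {k j : ℕ} {S T : Finset X} (m : ℕ)
    (hT : ¬ Cov ℓ k T) (hS : Cov ℓ j S) (hST : S ⊆ T) (hk : j + m = k) : #S + 2 * m < #T := by
  by_contra h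
  have := card_sdiff_add_card_eq_card hST
  exact hT (hk ▸ hS.extend hℓ m (by omega))

lemma sum_fibers_lt_of_not_cov (hℓ : ∀ x y, ∃ s, ℓ s x = ℓ s y) {k : ℕ} {T : Finset X} (m : ℕ)
    (hT : ¬ Cov ℓ k T) (s : Fin 7) (V : Finset β) (hk : #V + m = k) :
    ∑ v ∈ V, #{x ∈ T | ℓ s x = v} + 2 * m < #T := by
  rw [← card_filter_mem]
  refine card_lt_of_not_cov hℓ m hT (cov_of_image s V ?_) (filter_subset _ _) hk
  simp

lemma lt_numClasses_one {k : ℕ} {T : Finset X}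
    (hT : ¬ Cov ℓ k T) (s : Fin 7) : k < numClasses (ℓ s) T 1 := by
  rw [numClasses_one]
  by_contra h
  exact hT ((cov_of_image s (T.image (ℓ s)) fun x hx => mem_image_of_mem _ hx).mono (by omega)
    Subset.rfl)

lemma exists_classes {f : X → β} {S : Finset X} {k j : ℕ} (h : j ≤ numClasses f S k) :
    ∃ V : Finset β, #V = j ∧ ∀ v ∈ V, k ≤ #{x ∈ S | f x = v} := by
  obtain ⟨V, hV, hj⟩ := exists_subset_card_eq h
  exact ⟨V, hj, fun v hv => (mem_filter.1 (hV hv)).2⟩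

lemma exists_nested_classes {f : X → β} {S : Finset X} {k j k' j' : ℕ} (hk : k' ≤ k) (hj : j ≤ j')
    (h : j ≤ numClasses f S k) (h' : j' ≤ numClasses f S k') :
    ∃ V W : Finset β, V ⊆ W ∧ #V = j ∧ #W = j' ∧ (∀ v ∈ V, k ≤ #{x ∈ S | f x = v}) ∧
      ∀ v ∈ W, k' ≤ #{x ∈ S | f x = v} := by
  obtain ⟨V, hV, hVj⟩ := exists_subset_card_eq h
  have hVW : V ⊆ {v ∈ S.image f | k' ≤ #{x ∈ S | f x = v}} :=
    hV.trans (monotone_filter_right _ fun _ _ hv => hk.trans hv)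
  obtain ⟨W, hW, hW', hWj⟩ := exists_subsuperset_card_eq hVW (hVj ▸ hj) h'
  exact ⟨V, W, hW, hVj, hWj, fun v hv => (mem_filter.1 (hV hv)).2,
    fun v hv => (mem_filter.1 (hW' hv)).2⟩

/-- Without a cover of size `k`, there are no `j` classes of size `a` when they leave at most
`2 * (k - j)` points. -/
lemma numClasses_lt (hℓ : ∀ x y, ∃ s, ℓ s x = ℓ s y) {k : ℕ} {T : Finset X} {j a : ℕ} (m : ℕ)
    (hT : ¬ Cov ℓ k T) (s : Fin 7) (hk : j + m = k) (h : #T ≤ j * a + 2 * m) :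
    numClasses (ℓ s) T a < j := by
  by_contra hj
  obtain ⟨V, hV, hVa⟩ := exists_classes (not_lt.1 hj)
  have h1 := sum_fibers_lt_of_not_cov hℓ m hT s V (by omega)
  have h2 := card_nsmul_le_sum V _ a hVa
  rw [hV, smul_eq_mul] at h2
  omega

/-- Otherwise `i` classes of size at least `b + a`, `j` further ones of size at least `a`, and `m`
pairs would form a cover of size `k`. -/
lemma numClasses_lt_of_le (hℓ : ∀ x y, ∃ s, ℓ s x = ℓ s y) {k : ℕ} {T : Finset X} {i j a b : ℕ}
    (m : ℕ) (hT : ¬ Cov ℓ k T) (s : Fin 7) (hk : i + j + m = k)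
    (hi : i ≤ numClasses (ℓ s) T (b + a)) (h : #T ≤ i * b + (i + j) * a + 2 * m) :
    numClasses (ℓ s) T a < i + j := by
  by_contra hj
  obtain ⟨V, W, hVW, hV, hW, hVa, hWa⟩ :=
    exists_nested_classes (Nat.le_add_left a b) (Nat.le_add_right i j) hi (not_lt.1 hj)
  have h1 := sum_fibers_lt_of_not_cov hℓ m hT s W (by omega)
  have h2 := card_nsmul_le_sum V _ (b + a) hVa
  have h3 := card_nsmul_le_sum (W \ V) _ a fun v hv => hWa v (mem_sdiff.1 hv).1
  have h4 := sum_sdiff (f := fun v => #{x ∈ T | ℓ s x = v}) hVW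
  have h5 := card_sdiff_add_card_eq_card hVW
  have h6 : #(W \ V) = j := by omega
  rw [hV, smul_eq_mul, mul_add] at h2
  rw [h6, smul_eq_mul] at h3
  rw [add_mul] at h
  omega

lemma fiber_lt_of_not_cov (hℓ : ∀ x y, ∃ s, ℓ s x = ℓ s y) {k : ℕ} {T : Finset X} (m : ℕ)
    (hT : ¬ Cov ℓ k T) (s : Fin 7) (v : β) (hk : 1 + m = k) :
    #{x ∈ T | ℓ s x = v} + 2 * m < #T := by
  simpa using sum_fibers_lt_of_not_cov hℓ m hT s {v} (by simpa using hk)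

/-- Without such a cover, a side has at least five classes, none above size 3 and at most one of
size 3. It then joins at most 5 of the 36 pairs of nine points, or 6 of the 45 pairs of ten points,
too few for seven sides. -/
lemma cov_four_of_card_le_ten (hℓ : ∀ x y, ∃ s, ℓ s x = ℓ s y) (S : Finset X) (h : #S ≤ 10) :
    Cov ℓ 4 S := by
  by_contra hS
  have h8 : 8 < #S := by
    by_contra h8
    exact hS (cov_of_card_le hℓ 4 S (by omega))
  have key : ∀ s, #(samePairs (ℓ s) S) + 8 ≤ 2 * #S := by
    intro s
    have hf : ∀ v, #{x ∈ S | ℓ s x = v} ≤ 3 := fun v => by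
      have := fiber_lt_of_not_cov hℓ 3 hS s v (by norm_num)
      omega
    have hf5 : ∀ v, #{x ∈ S | ℓ s x = v} ≤ 5 := fun v => (hf v).trans (by norm_num)
    have h1 := card_eq_numClasses _ S hf5
    have h2 := card_samePairs_eq _ S hf5
    have h3 := numClasses_lt (j := 2) (a := 3) hℓ 2 hS s (by norm_num) (by omega)
    have h4 := lt_numClasses_one hS s
    have h5 := numClasses_eq_zero _ S hf (k := 4) (by norm_num)
    have h6 := numClasses_eq_zero _ S hf (k := 5) (by norm_num)
    omega
  have h1 := card_offDiag_le hℓ S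
  have h2 := sum_le_sum fun s (_ : s ∈ (univ : Finset (Fin 7))) => key s
  simp only [sum_add_distrib, sum_const, card_univ, Fintype.card_fin, smul_eq_mul] at h2
  obtain h9 | h10 : #S = 9 ∨ #S = 10 := by omega
  · rw [h9] at h1 h2; omega
  · rw [h10] at h1 h2; omega

variable [Fintype X]

lemma card_lt_of_cov (hℓ : ∀ x y, ∃ s, ℓ s x = ℓ s y) (hX : Fintype.card X = 16)
    (hN : ¬ Cov ℓ 5 univ) {j : ℕ} {S : Finset X} (m : ℕ) (hS : Cov ℓ j S) (hk : j + m = 5) :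
    #S + 2 * m < 16 := by
  have := card_lt_of_not_cov hℓ m hN hS (subset_univ S) hk
  rwa [card_univ, hX] at this

/-- A block of six points would leave at most ten, which four classes cover. -/
lemma IsBlock.card_le_five (hℓ : ∀ x y, ∃ s, ℓ s x = ℓ s y) (hX : Fintype.card X = 16)
    (hN : ¬ Cov ℓ 5 univ) {B : Finset X} (hB : IsBlock ℓ B) : #B ≤ 5 := by
  by_contra h
  have h1 := card_sdiff_add_card_eq_card (subset_univ B)
  rw [card_univ, hX] at h1
  have := hB.cov.union (cov_four_of_card_le_ten hℓ (univ \ B) (by omega))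
  exact hN (this.mono (by norm_num) (by simp))

/-- The two blocks would leave at most six points, that is, three pairs. The next two lemmas use the
same accounting, with four and two points left. -/
lemma no_five_five (hℓ : ∀ x y, ∃ s, ℓ s x = ℓ s y) (hX : Fintype.card X = 16)
    (hN : ¬ Cov ℓ 5 univ) {A B : Finset X} (hA : IsBlock ℓ A) (hB : IsBlock ℓ B)
    (hAB : Disjoint A B) (hA5 : #A = 5) : #B < 5 := by
  have := card_lt_of_cov hℓ hX hN 3 (hA.cov.union hB.cov) (by norm_num)
  rw [card_union_of_disjoint hAB] at this
  omega

lemma no_five_four_three (hℓ : ∀ x y, ∃ s, ℓ s x = ℓ s y) (hX : Fintype.card X = 16)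
    (hN : ¬ Cov ℓ 5 univ) {A B C : Finset X} (hA : IsBlock ℓ A) (hB : IsBlock ℓ B)
    (hC : IsBlock ℓ C) (hAB : Disjoint A B) (hAC : Disjoint A C) (hBC : Disjoint B C)
    (hA5 : #A = 5) (hB4 : 4 ≤ #B) : #C < 3 := by
  have := card_lt_of_cov hℓ hX hN 2 ((hA.cov.union hB.cov).union hC.cov) (by norm_num)
  rw [card_union_of_disjoint (disjoint_union_left.2 ⟨hAC, hBC⟩), card_union_of_disjoint hAB] at this
  omega

lemma no_five_three_three_three (hℓ : ∀ x y, ∃ s, ℓ s x = ℓ s y) (hX : Fintype.card X = 16)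
    (hN : ¬ Cov ℓ 5 univ) {A B C D : Finset X} (hA : IsBlock ℓ A) (hB : IsBlock ℓ B)
    (hC : IsBlock ℓ C) (hD : IsBlock ℓ D) (hAB : Disjoint A B) (hAC : Disjoint A C)
    (hAD : Disjoint A D) (hBC : Disjoint B C) (hBD : Disjoint B D) (hCD : Disjoint C D)
    (hA5 : #A = 5) (hB3 : 3 ≤ #B) (hC3 : 3 ≤ #C) : #D < 3 := by
  have := card_lt_of_cov hℓ hX hN 1 (((hA.cov.union hB.cov).union hC.cov).union hD.cov)
    (by norm_num)
  rw [card_union_of_disjoint (by simp [*]), card_union_of_disjoint (by simp [*]),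
    card_union_of_disjoint hAB] at this
  omega

/-- The class sizes of one side, and the number of pairs that it joins. -/
lemma class_sizes (hℓ : ∀ x y, ∃ s, ℓ s x = ℓ s y) (hX : Fintype.card X = 16)
    (hN : ¬ Cov ℓ 5 univ) (s : Fin 7) :
    16 = numClasses (ℓ s) univ 1 + numClasses (ℓ s) univ 2 + numClasses (ℓ s) univ 3
      + numClasses (ℓ s) univ 4 + numClasses (ℓ s) univ 5 ∧
    #(samePairs (ℓ s) univ) = 2 * numClasses (ℓ s) univ 2 + 4 * numClasses (ℓ s) univ 3
      + 6 * numClasses (ℓ s) univ 4 + 8 * numClasses (ℓ s) univ 5 ∧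
    5 < numClasses (ℓ s) univ 1 ∧ numClasses (ℓ s) univ 5 < 2 ∧ numClasses (ℓ s) univ 4 < 3 ∧
    (2 ≤ numClasses (ℓ s) univ 4 → numClasses (ℓ s) univ 3 < 4) ∧
    (1 ≤ numClasses (ℓ s) univ 5 → numClasses (ℓ s) univ 3 < 4) := by
  have hf : ∀ v, #{x | ℓ s x = v} ≤ 5 := fun v =>
    IsBlock.card_le_five hℓ hX hN ⟨s, v, by simp⟩
  have h1 := card_eq_numClasses (ℓ s) univ hf
  rw [card_univ, hX] at h1
  have hX' : #(univ : Finset X) = 16 := by rw [card_univ, hX]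
  exact ⟨h1, card_samePairs_eq (ℓ s) univ hf, lt_numClasses_one hN s,
    numClasses_lt hℓ 3 hN s (by norm_num) (by omega),
    numClasses_lt hℓ 2 hN s (by norm_num) (by omega),
    fun h => numClasses_lt_of_le (i := 2) (j := 2) (b := 1) hℓ 1 hN s (by norm_num) h (by omega),
    fun h => numClasses_lt_of_le (i := 1) (j := 3) (b := 2) hℓ 1 hN s (by norm_num) h (by omega)⟩

/-- With classes of size at most 4, the best profile for one side is 4,4,3,2,2,1, which joins 17
pairs; seven sides join at most 119 of the 120 pairs. -/
lemma exists_five_block (hℓ : ∀ x y, ∃ s, ℓ s x = ℓ s y) (hX : Fintype.card X = 16)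
    (hN : ¬ Cov ℓ 5 univ) : ∃ s v, #{x | ℓ s x = v} = 5 := by
  by_contra h
  push Not at h
  have key : ∀ s, #(samePairs (ℓ s) univ) ≤ 34 := by
    intro s
    have hf : ∀ v, #{x | ℓ s x = v} ≤ 4 := fun v => by
      have h1 := IsBlock.card_le_five hℓ hX hN (B := {x | ℓ s x = v}) ⟨s, v, by simp⟩
      have h2 := h s v
      omega
    have h0 := numClasses_eq_zero (ℓ s) univ hf (k := 5) (by norm_num)
    have h32 := numClasses_anti (ℓ s) univ (show 2 ≤ 3 by norm_num)
    have h43 := numClasses_anti (ℓ s) univ (show 3 ≤ 4 by norm_num)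
    obtain ⟨h1, h2, h3, h4, h5, h6, h7⟩ := class_sizes hℓ hX hN s
    omega
  have h1 := card_offDiag_le hℓ (univ : Finset X)
  have h2 := sum_le_sum fun s (_ : s ∈ (univ : Finset (Fin 7))) => key s
  simp only [sum_const, card_univ, Fintype.card_fin, smul_eq_mul, hX] at h1 h2
  omega

end PartitionCover

/-! ### A 5-block disjoint from a 4-block -/

namespace PartitionCover

open Finset

variable {X β : Type*} [DecidableEq X] [DecidableEq β] {ℓ : Fin 7 → X → β} [Fintype X]

lemma card_pairs_not_inside (F : Finset X) (f : X → β) :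
    #{p ∈ (univ : Finset X).offDiag \ F.offDiag | f p.1 = f p.2} + #(samePairs f F) =
      #(samePairs f univ) := by
  have h1 : {p ∈ (univ : Finset X).offDiag \ F.offDiag | f p.1 = f p.2} =
      samePairs f univ \ samePairs f F := by
    ext p
    simp only [samePairs, mem_filter, mem_sdiff, mem_offDiag]
    grind
  rw [h1]
  refine card_sdiff_add_card_eq_card fun p hp => ?_
  simp only [samePairs, mem_filter, mem_offDiag] at hp ⊢
  exact ⟨⟨mem_univ _, mem_univ _, hp.1.2.2⟩, hp.2⟩

/-- If every `5`-block meets every `4`-block, then a side joins at most `17` pairs that are not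
inside a given `5`-block `F`, and in the extremal case two points of `F` lie in classes with three
points outside `F`. -/
lemma side_bound (hℓ : ∀ x y, ∃ s, ℓ s x = ℓ s y) (hX : Fintype.card X = 16)
    (hN : ¬ Cov ℓ 5 univ)
    (hno : ∀ F D, IsBlock ℓ F → IsBlock ℓ D → Disjoint F D → #F = 5 → #D < 4)
    {F : Finset X} (hF : IsBlock ℓ F) (hF5 : #F = 5) (s : Fin 7) :
    #(samePairs (ℓ s) univ) ≤ 36 ∧ #(samePairs (ℓ s) univ) ≤ 34 + #(samePairs (ℓ s) F) ∧
      (#(samePairs (ℓ s) univ) = 34 + #(samePairs (ℓ s) F) →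
        2 ≤ #{x ∈ F | 3 ≤ #{y ∈ univ \ F | ℓ s y = ℓ s x}}) := by
  obtain ⟨h1, h2, h3, h4, h5, h6, h7⟩ := class_sizes hℓ hX hN s
  have h21 := numClasses_anti (ℓ s) univ (show 1 ≤ 2 by norm_num)
  have h32 := numClasses_anti (ℓ s) univ (show 2 ≤ 3 by norm_num)
  have h43 := numClasses_anti (ℓ s) univ (show 3 ≤ 4 by norm_num)
  have hC : ∀ v, #{y ∈ univ \ F | ℓ s y = v} < 4 := fun v =>
    hno F _ hF ⟨s, v, by simp⟩
      (disjoint_sdiff.mono_right (filter_subset _ _)) hF5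
  have hsplit : ∀ v, #{x ∈ F | ℓ s x = v} + #{y ∈ univ \ F | ℓ s y = v} = #{x | ℓ s x = v} := by
    intro v
    rw [← card_union_of_disjoint (disjoint_filter_filter disjoint_sdiff), ← filter_union,
      union_sdiff_of_subset (subset_univ F)]
  have hin : ∀ v, #{x ∈ F | ℓ s x = v} * #{x ∈ F | ℓ s x = v} - #{x ∈ F | ℓ s x = v}
      ≤ #(samePairs (ℓ s) F) := by
    intro v
    rw [← offDiag_card]
    refine card_le_card fun p hp => ?_
    simp only [mem_offDiag, mem_filter, samePairs] at hp ⊢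
    grind
  -- Without a 5-class, equality forces two 4-classes and no pair inside `F`; each 4-class must meet
  -- `F`, hence in exactly one point. With a 5-class, no other class has four points, and equality
  -- forces the 5-class to have two points in `F` and three outside.
  by_cases h8 : numClasses (ℓ s) univ 5 = 0
  · refine ⟨by omega, by omega, fun heq => ?_⟩
    have hF0 : #(samePairs (ℓ s) F) = 0 := by omega
    obtain ⟨V, hV, hV4⟩ := exists_classes (show 2 ≤ numClasses (ℓ s) univ 4 by omega)
    have hx : ∀ v ∈ V, ∃ x ∈ F, ℓ s x = v ∧ 3 ≤ #{y ∈ univ \ F | ℓ s y = v} := by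
      intro v hv
      have a1 := hV4 v hv
      have a2 := hC v
      have a3 := hsplit v
      have a4 := hin v
      rw [hF0] at a4
      have a5 : #{x ∈ F | ℓ s x = v} ≤ 1 := by
        by_contra hlt
        have := Nat.mul_le_mul_right #{x ∈ F | ℓ s x = v} (show 2 ≤ #{x ∈ F | ℓ s x = v} by omega)
        omega
      obtain ⟨x, hx⟩ := card_pos.1 (show 0 < #{x ∈ F | ℓ s x = v} by omega)
      rw [mem_filter] at hx
      exact ⟨x, hx.1, hx.2, by omega⟩
    rw [← hV]
    refine (card_le_card (t := image (ℓ s) {x ∈ F | 3 ≤ #{y ∈ univ \ F | ℓ s y = ℓ s x}})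
      fun v hv => ?_).trans card_image_le
    obtain ⟨x, hxF, rfl, hx3⟩ := hx v hv
    exact mem_image_of_mem _ (mem_filter.2 ⟨hxF, hx3⟩)
  · have h9 : numClasses (ℓ s) univ 4 < 2 := by
      by_contra h9
      obtain ⟨V, W, hVW, hV, hW, hV5, hW4⟩ := exists_nested_classes (show 4 ≤ 5 by norm_num)
        (show 1 ≤ 2 by norm_num) (Nat.one_le_iff_ne_zero.2 h8) (not_lt.1 h9)
      obtain ⟨v, rfl⟩ := card_eq_one.1 hV
      obtain ⟨w, hw, hwv⟩ := exists_mem_ne (by omega : 1 < #W) v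
      have b1 : IsBlock ℓ {x | ℓ s x = v} := ⟨s, v, by simp⟩
      have b2 : IsBlock ℓ {x | ℓ s x = w} := ⟨s, w, by simp⟩
      have b3 := b1.card_le_five hℓ hX hN
      have b4 := hV5 v (by simp)
      have b5 := hno _ _ b1 b2 (disjoint_filter.2 fun x _ e e' => hwv (e'.symm.trans e)) (by omega)
      have b6 := hW4 w hw
      omega
    obtain ⟨V, hV, hV5⟩ := exists_classes (show 1 ≤ numClasses (ℓ s) univ 5 by omega)
    obtain ⟨v, rfl⟩ := card_eq_one.1 hV
    have a1 := hV5 v (by simp)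
    have a2 := hC v
    have a3 := hsplit v
    have a4 := hin v
    have a5 : #{x ∈ F | ℓ s x = v} ≤ 5 := (card_filter_le _ _).trans hF5.le
    have a6 : ∀ x ∈ ({x ∈ F | ℓ s x = v} : Finset X), ℓ s x = v := fun x hx => (mem_filter.1 hx).2
    refine ⟨by omega, ?_, fun heq => ?_⟩
    · have : 2 ≤ #(samePairs (ℓ s) F) := by
        refine le_trans ?_ a4
        have : 2 ≤ #{x ∈ F | ℓ s x = v} := by omega
        generalize #{x ∈ F | ℓ s x = v} = n at *
        interval_cases n <;> norm_num
      omega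
    · have hle : #(samePairs (ℓ s) F) ≤ 2 := by omega
      have h2' : #{x ∈ F | ℓ s x = v} = 2 := by
        have : 2 ≤ #{x ∈ F | ℓ s x = v} := by omega
        have := a4.trans hle
        generalize #{x ∈ F | ℓ s x = v} = n at *
        interval_cases n <;> omega
      rw [← h2']
      refine card_le_card fun x hx => ?_
      rw [mem_filter] at hx ⊢
      exact ⟨hx.1, by rw [hx.2]; omega⟩

/-- Otherwise `side_bound` leaves no slack in counting the pairs not inside a 5-block `F`. Equality
provides a point of `F` with three disjoint triples outside `F`, each lying in one of its classes:
the forbidden 5,3,3,3. -/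
lemma exists_disjoint_five_four (hℓ : ∀ x y, ∃ s, ℓ s x = ℓ s y) (hX : Fintype.card X = 16)
    (hN : ¬ Cov ℓ 5 univ) :
    ∃ F D, IsBlock ℓ F ∧ IsBlock ℓ D ∧ Disjoint F D ∧ #F = 5 ∧ #D = 4 := by
  by_contra hcon
  have hno : ∀ F D, IsBlock ℓ F → IsBlock ℓ D → Disjoint F D → #F = 5 → #D < 4 := by
    intro F D hF hD hFD h5
    by_contra h4
    obtain ⟨D', hD', h4'⟩ := exists_subset_card_eq (not_lt.1 h4)
    exact hcon ⟨F, D', hF, hD.mono hD', hFD.mono_right hD', h5, h4'⟩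
  obtain ⟨s₀, v₀, hF5⟩ := exists_five_block hℓ hX hN
  set F : Finset X := {x | ℓ s₀ x = v₀} with hFdef
  have hF : IsBlock ℓ F := ⟨s₀, v₀, by simp [F]⟩
  have hbound := side_bound hℓ hX hN hno hF hF5
  set P := (univ : Finset X).offDiag \ F.offDiag with hP
  have hPc : #P = 220 := by
    have := card_sdiff_add_card_eq_card (offDiag_mono (subset_univ F))
    rw [← hP, offDiag_card, offDiag_card, hF5, card_univ, hX] at this
    omega
  have hsum : ∀ s, #{p ∈ P | ℓ s p.1 = ℓ s p.2} + #(samePairs (ℓ s) F) =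
      #(samePairs (ℓ s) univ) := fun s => card_pairs_not_inside F (ℓ s)
  have h0 : #(samePairs (ℓ s₀) F) = 20 := by
    rw [samePairs, filter_true_of_mem, offDiag_card, hF5]
    intro p hp
    simp only [mem_offDiag, hFdef, mem_filter, mem_univ, true_and] at hp
    rw [hp.1, hp.2.1]
  have hPcov : ∀ p ∈ P, ∃ s, ℓ s p.1 = ℓ s p.2 := fun p _ => hℓ _ _
  have hlow := card_le_sum_pairs hPcov
  have hle : ∀ s, #{p ∈ P | ℓ s p.1 = ℓ s p.2} ≤ if s = s₀ then 16 else 34 := by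
    intro s
    have a := hbound s
    have b := hsum s
    split_ifs with h
    · subst h
      omega
    · omega
  -- The side of `F` contributes at most `36 - 20`, and `16 + 6 * 34` is exactly the number of
  -- ordered pairs not inside `F`, so every bound is tight.
  have hval : ∑ s : Fin 7, (if s = s₀ then 16 else 34) = 220 := by
    fin_cases s₀ <;> rfl
  have hupp := sum_le_sum fun s (_ : s ∈ (univ : Finset (Fin 7))) => hle s
  have heq := (sum_eq_sum_iff_of_le fun s (_ : s ∈ (univ : Finset (Fin 7))) => hle s).1
    (by omega)
  have huniq : ∀ p ∈ P, ∀ s t, ℓ s p.1 = ℓ s p.2 → ℓ t p.1 = ℓ t p.2 → s = t :=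
    fun p hp s t hs ht => side_unique_of_sum_le hPcov (by omega) hp hs ht
  have hinc : ∀ s ∈ univ.erase s₀, 2 ≤ #{x ∈ F | 3 ≤ #{y ∈ univ \ F | ℓ s y = ℓ s x}} := by
    intro s hs
    refine (hbound s).2.2 ?_
    have a := heq s (mem_univ s)
    rw [if_neg (ne_of_mem_erase hs)] at a
    have b := hsum s
    omega
  have hdc : ∑ x ∈ F, #{s ∈ univ.erase s₀ | 3 ≤ #{y ∈ univ \ F | ℓ s y = ℓ s x}} =
      ∑ s ∈ univ.erase s₀, #{x ∈ F | 3 ≤ #{y ∈ univ \ F | ℓ s y = ℓ s x}} := by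
    simp only [card_filter (p := fun _ => 3 ≤ _)]
    rw [sum_comm]
  have h12 := card_nsmul_le_sum _ _ 2 hinc
  rw [card_erase_of_mem (mem_univ _), card_univ, Fintype.card_fin, ← hdc, smul_eq_mul] at h12
  -- Six sides give at least 12 incidences with the five points of `F`, so some point has three.
  obtain ⟨x, hx, hx3⟩ := exists_lt_of_sum_lt (s := F) (f := fun _ => 2)
    (g := fun x => #{s ∈ univ.erase s₀ | 3 ≤ #{y ∈ univ \ F | ℓ s y = ℓ s x}})
    (by rw [sum_const, hF5]; norm_num; omega)
  obtain ⟨s, hs, t, ht, r, hr, hst, hsr, htr⟩ := two_lt_card.1 hx3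
  rw [mem_filter] at hs ht hr
  have hblk : ∀ s, IsBlock ℓ {y ∈ univ \ F | ℓ s y = ℓ s x} := fun s => ⟨s, ℓ s x, by simp⟩
  have hdis : ∀ s t, s ≠ t → Disjoint {y ∈ univ \ F | ℓ s y = ℓ s x}
      {y ∈ univ \ F | ℓ t y = ℓ t x} := by
    intro s t hst
    rw [disjoint_left]
    intro y hy hy'
    rw [mem_filter, mem_sdiff] at hy hy'
    refine hst (huniq (y, x) ?_ s t hy.2 hy'.2)
    rw [hP, mem_sdiff, mem_offDiag, mem_offDiag]
    exact ⟨⟨mem_univ _, mem_univ _, fun e => hy.1.2 (by rw [show y = x from e]; exact hx)⟩, fun h => hy.1.2 h.1⟩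
  have hFd : ∀ s, Disjoint F {y ∈ univ \ F | ℓ s y = ℓ s x} := fun s =>
    disjoint_sdiff.mono_right (filter_subset _ _)
  exact absurd hr.2 (not_le.2 (no_five_three_three_three hℓ hX hN hF (hblk s) (hblk t) (hblk r)
    (hFd s) (hFd t) (hFd r) (hdis s t hst) (hdis s r hsr) (hdis t r htr) hF5 hs.2 ht.2))

end PartitionCover

namespace PartitionCover

open Finset

variable {X : Type*} [DecidableEq X]

/-! ### Rainbow matchings in the complete graph on seven vertices -/

/-- Greedy choice: a new set adds at most one point to the union unless it is a pair disjoint from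
everything before, in which case it joins `I`. -/
lemma exists_disjoint_pairs {ι : Type*} [DecidableEq ι] (A : ι → Finset X) (T : Finset ι)
    (h : ∀ i ∈ T, #(A i) ≤ 2) :
    ∃ I ⊆ T, (∀ i ∈ I, #(A i) = 2) ∧ (I : Set ι).PairwiseDisjoint A ∧
      #(T.biUnion A) ≤ #I + #T := by
  induction T using Finset.induction_on with
  | empty => exact ⟨∅, by simp⟩
  | insert i T hi ih =>
    obtain ⟨I, hI, hI2, hId, hc⟩ := ih fun j hj => h j (mem_insert_of_mem hj)
    have h2 := h i (mem_insert_self i T)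
    rw [biUnion_insert, card_insert_of_notMem hi]
    by_cases hA : #(A i) = 2 ∧ Disjoint (A i) (T.biUnion A)
    · refine ⟨insert i I, insert_subset_insert _ hI, ?_, ?_, ?_⟩
      · simpa [hA.1] using hI2
      · rw [coe_insert]
        refine hId.insert fun j hj _ => hA.2.mono_right ?_
        exact subset_biUnion_of_mem A (hI hj)
      · rw [card_insert_of_notMem fun hiI => hi (hI hiI), card_union_of_disjoint hA.2, hA.1]
        omega
    · refine ⟨I, hI.trans (subset_insert _ _), hI2, hId, ?_⟩
      have h1 := card_union_add_card_inter (A i) (T.biUnion A)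
      have h3 : #(A i) = 2 → 0 < #(A i ∩ T.biUnion A) := fun e => by
        rw [card_pos]
        exact not_disjoint_iff_nonempty_inter.1 fun hd => hA ⟨e, hd⟩
      omega

/-- The edges of the complete graph on `{0, …, 6}`, as bit masks. -/
def edgeMasks : List ℕ :=
  [3, 5, 6, 9, 10, 12, 17, 18, 20, 24, 33, 34, 36, 40, 48, 65, 66, 68, 72, 80, 96]

/-- No edge of `A` and edge of `B` form a matching of size three together with `r`. -/
def noRainbow (A B : List ℕ) (r : ℕ) : Bool :=
  A.all fun a => a &&& r != 0 || B.all fun b => b &&& r != 0 || a &&& b != 0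

/-- The increasing matchings of size two with edges in `L`. -/
def matchingsTwo (L : List ℕ) : List (List ℕ) :=
  L.flatMap fun p => (L.filter fun q => p.blt q && p &&& q == 0).map fun q => [p, q]

/-- The increasing matchings of size three with edges in `L`. -/
def matchingsThree (L : List ℕ) : List (List ℕ) :=
  (matchingsTwo L).flatMap fun t =>
    (L.filter fun r => t.all fun p => p.blt r && p &&& r == 0).map fun r => r :: t

/-- The first matching is normalised to the masks 3, 12, 48. Edges already used, and edges that
complete a rainbow matching, are discarded at each stage; no two disjoint edges are then left for
the fourth matching. -/
lemma rainbow_masks :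
    ∀ B ∈ matchingsThree (edgeMasks.filter fun m => [3, 12, 48].all fun a => a != m),
    ∀ C ∈ matchingsThree (edgeMasks.filter fun m =>
      ([3, 12, 48].all fun a => a != m) && (B.all fun b => b != m) && noRainbow [3, 12, 48] B m),
    matchingsTwo (edgeMasks.filter fun m => ([3, 12, 48].all fun a => a != m) &&
      (B.all fun b => b != m) && (C.all fun c => c != m) && noRainbow [3, 12, 48] B m &&
      noRainbow [3, 12, 48] C m && noRainbow B C m) = [] := by
  decide +kernel

lemma exists_mask : ∀ i j : Fin 7, i ≠ j →
    ∃ m ∈ edgeMasks, ∀ k : Fin 7, m.testBit k = true ↔ k = i ∨ k = j := by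
  decide +kernel

lemma land_eq_zero : ∀ m ∈ edgeMasks, ∀ n ∈ edgeMasks,
    (∀ k : Fin 7, ¬ (m.testBit k = true ∧ n.testBit k = true)) → m &&& n = 0 := by
  decide +kernel

end PartitionCover

/-! ### From bit masks to matchings on a seven-point set -/

namespace PartitionCover

open Finset

variable {X : Type*} [DecidableEq X]

/-- The set of points `x i` for which the `i`-th bit of `m` is set. -/
def maskSet (x : Fin 7 → X) (m : ℕ) : Finset X :=
  ({i : Fin 7 | m.testBit i = true} : Finset (Fin 7)).image x

lemma disjoint_maskSet {x : Fin 7 → X} (hx : Function.Injective x) {m n : ℕ} (h : m &&& n = 0) :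
    Disjoint (maskSet x m) (maskSet x n) := by
  rw [maskSet, maskSet, disjoint_image hx, disjoint_filter]
  intro i _ hi hj
  have := Nat.testBit_and m n i
  rw [h, hi, hj] at this
  simp at this

lemma land_eq_zero_of_disjoint {x : Fin 7 → X} {m n : ℕ} (hm : m ∈ edgeMasks)
    (hn : n ∈ edgeMasks) (h : Disjoint (maskSet x m) (maskSet x n)) : m &&& n = 0 := by
  refine land_eq_zero m hm n hn fun k hk => ?_
  have h1 : x k ∈ maskSet x m := mem_image_of_mem x (by simp [hk])
  have h2 : x k ∈ maskSet x n := mem_image_of_mem x (by simp [hk])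
  exact disjoint_left.1 h h1 h2

lemma eq_of_testBit_eq : ∀ m ∈ edgeMasks, ∀ n ∈ edgeMasks,
    (∀ k : Fin 7, m.testBit k = true ↔ n.testBit k = true) → m = n := by
  decide +kernel

lemma maskSet_injOn {x : Fin 7 → X} (hx : Function.Injective x) {m n : ℕ} (hm : m ∈ edgeMasks)
    (hn : n ∈ edgeMasks) (h : maskSet x m = maskSet x n) : m = n := by
  refine eq_of_testBit_eq m hm n hn fun k => ?_
  have := congrArg (k ∈ ·) (image_injective hx h)
  simpa using this

lemma exists_lt_lt_of_three_le_card {N : Finset ℕ} (h : 3 ≤ #N) :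
    ∃ p ∈ N, ∃ q ∈ N, ∃ r ∈ N, p < q ∧ q < r := by
  let f := N.orderEmbOfCardLe h
  exact ⟨f 0, N.orderEmbOfCardLe_mem h 0, f 1, N.orderEmbOfCardLe_mem h 1, f 2,
    N.orderEmbOfCardLe_mem h 2, f.strictMono (by decide), f.strictMono (by decide)⟩

lemma exists_lt_of_two_le_card {N : Finset ℕ} (h : 2 ≤ #N) : ∃ p ∈ N, ∃ q ∈ N, p < q := by
  let f := N.orderEmbOfCardLe h
  exact ⟨f 0, N.orderEmbOfCardLe_mem h 0, f 1, N.orderEmbOfCardLe_mem h 1,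
    f.strictMono (by decide)⟩

lemma mem_matchingsTwo {L : List ℕ} {p q : ℕ} (hp : p ∈ L) (hq : q ∈ L) (hpq : p < q)
    (h : p &&& q = 0) : [p, q] ∈ matchingsTwo L := by
  simp only [matchingsTwo, List.mem_flatMap, List.mem_map, List.mem_filter]
  exact ⟨p, hp, q, ⟨hq, by simp [h, hpq]⟩, rfl⟩

lemma mem_matchingsThree {L : List ℕ} {p q r : ℕ} (hp : p ∈ L) (hq : q ∈ L) (hr : r ∈ L)
    (hpq : p < q) (hqr : q < r) (h : p &&& q = 0) (h' : p &&& r = 0) (h'' : q &&& r = 0) :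
    [r, p, q] ∈ matchingsThree L := by
  simp only [matchingsThree, List.mem_flatMap, List.mem_map, List.mem_filter]
  exact ⟨[p, q], mem_matchingsTwo hp hq hpq h, r, ⟨hr, by simp [h', h'', hqr, hpq.trans hqr]⟩, rfl⟩

/-- A `7`-set can be labelled so that a given matching of size three becomes the standard one. -/
lemma exists_labelling {E : Finset X} (hE : #E = 7) {M : Finset (Finset X)} (hM : 3 ≤ #M)
    (h2 : ∀ A ∈ M, A ⊆ E ∧ #A = 2) (hd : (M : Set (Finset X)).PairwiseDisjoint id) :
    ∃ x : Fin 7 → X, Function.Injective x ∧ univ.image x = E ∧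
      ∀ m ∈ [3, 12, 48], maskSet x m ∈ M := by
  obtain ⟨A, hA, B, hB, C, hC, hAB, hAC, hBC⟩ := two_lt_card.1 hM
  have dAB : Disjoint A B := hd hA hB hAB
  have dAC : Disjoint A C := hd hA hC hAC
  have dBC : Disjoint B C := hd hB hC hBC
  obtain ⟨x0, x1, -, rfl⟩ := card_eq_two.1 (h2 A hA).2
  obtain ⟨x2, x3, -, rfl⟩ := card_eq_two.1 (h2 B hB).2
  obtain ⟨x4, x5, -, rfl⟩ := card_eq_two.1 (h2 C hC).2
  have hsub : {x0, x1} ∪ {x2, x3} ∪ {x4, x5} ⊆ E :=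
    union_subset (union_subset (h2 _ hA).1 (h2 _ hB).1) (h2 _ hC).1
  have hcard : #({x0, x1} ∪ {x2, x3} ∪ {x4, x5} : Finset X) = 6 := by
    rw [card_union_of_disjoint (disjoint_union_left.2 ⟨dAC, dBC⟩), card_union_of_disjoint dAB,
      (h2 _ hA).2, (h2 _ hB).2, (h2 _ hC).2]
  have hrest := card_sdiff_add_card_eq_card hsub
  obtain ⟨x6, h6⟩ := card_eq_one.1 (show #(E \ ({x0, x1} ∪ {x2, x3} ∪ {x4, x5})) = 1 by omega)
  have hEx : univ.image ![x0, x1, x2, x3, x4, x5, x6] = E := by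
    rw [← union_sdiff_of_subset hsub, h6]
    ext y
    simp [Fin.exists_fin_succ]
    grind
  refine ⟨_, ?_, hEx, ?_⟩
  · rw [← Set.injOn_univ, ← coe_univ, ← card_image_iff, hEx, hE]
    rfl
  · have e3 : ({i : Fin 7 | Nat.testBit 3 i = true} : Finset (Fin 7)) = {0, 1} := by decide
    have e12 : ({i : Fin 7 | Nat.testBit 12 i = true} : Finset (Fin 7)) = {2, 3} := by decide
    have e48 : ({i : Fin 7 | Nat.testBit 48 i = true} : Finset (Fin 7)) = {4, 5} := by decide
    intro m hm
    simp only [List.mem_cons, List.not_mem_nil, or_false] at hm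
    rcases hm with rfl | rfl | rfl
    · rw [maskSet, e3]; simpa [image_insert] using hA
    · rw [maskSet, e12]; simpa [image_insert] using hB
    · rw [maskSet, e48]; simpa [image_insert] using hC

/-- Labelling the seven points so that `M 0` contains the standard matching translates a
counterexample into masks, which `rainbow_masks` excludes. -/
lemma exists_rainbow {E : Finset X} (hE : #E = 7) (M : Fin 4 → Finset (Finset X))
    (h2 : ∀ i, ∀ A ∈ M i, A ⊆ E ∧ #A = 2)
    (hd : ∀ i, (M i : Set (Finset X)).PairwiseDisjoint id)
    (hne : ∀ i j, i ≠ j → Disjoint (M i) (M j))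
    (h3 : ∀ i, i ≠ 3 → 3 ≤ #(M i)) (h3' : 2 ≤ #(M 3)) :
    ∃ i j k, i ≠ j ∧ i ≠ k ∧ j ≠ k ∧ ∃ A ∈ M i, ∃ B ∈ M j, ∃ C ∈ M k,
      Disjoint A B ∧ Disjoint A C ∧ Disjoint B C := by
  by_contra hcon
  obtain ⟨x, hx, hxE, hx0⟩ := exists_labelling hE (h3 0 (by decide)) (h2 0) (hd 0)
  let N : Fin 4 → Finset ℕ := fun i => {m ∈ edgeMasks.toFinset | maskSet x m ∈ M i}
  have hN : ∀ {i m}, m ∈ N i → m ∈ edgeMasks ∧ maskSet x m ∈ M i := by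
    intro i m hm
    simpa [N] using hm
  have hMN : ∀ i, #(M i) ≤ #(N i) := by
    intro i
    refine (card_le_card (t := (N i).image (maskSet x)) fun A hA => ?_).trans card_image_le
    obtain ⟨hAE, hA2⟩ := h2 i A hA
    obtain ⟨a, b, hab, rfl⟩ := card_eq_two.1 hA2
    rw [← hxE] at hAE
    obtain ⟨k, -, rfl⟩ := mem_image.1 (hAE (mem_insert_self _ _))
    obtain ⟨l, -, rfl⟩ := mem_image.1 (hAE (mem_insert_of_mem (mem_singleton_self _)))
    obtain ⟨m, hm, hml⟩ := exists_mask k l fun e => hab (by rw [e])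
    have hS : maskSet x m = {x k, x l} := by
      have : ({i : Fin 7 | m.testBit i = true} : Finset (Fin 7)) = {k, l} := by
        ext i
        simp [hml]
      rw [maskSet, this, image_insert, image_singleton]
    refine mem_image.2 ⟨m, ?_, hS⟩
    simp only [N, mem_filter, List.mem_toFinset]
    exact ⟨hm, hS ▸ hA⟩
  have hland : ∀ {i m n}, m ∈ N i → n ∈ N i → m < n → m &&& n = 0 := by
    intro i m n hm hn hmn
    exact land_eq_zero_of_disjoint (hN hm).1 (hN hn).1 (hd i (hN hm).2 (hN hn).2 fun e =>
      hmn.ne (maskSet_injOn hx (hN hm).1 (hN hn).1 e))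
  have hdiff : ∀ {i j m n}, i ≠ j → m ∈ N i → n ∈ N j → (m != n) = true := by
    intro i j m n hij hm hn
    rw [bne_iff_ne]
    rintro rfl
    exact disjoint_left.1 (hne i j hij) (hN hm).2 (hN hn).2
  have hfree : ∀ {i j k m} {A B : List ℕ}, i ≠ j → i ≠ k → j ≠ k → (∀ a ∈ A, a ∈ N i) →
      (∀ b ∈ B, b ∈ N j) → m ∈ N k → noRainbow A B m = true := by
    intro i j k m A B hij hik hjk hA hB hm
    simp only [noRainbow, List.all_eq_true, Bool.or_eq_true, bne_iff_ne, or_iff_not_imp_left,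
      not_not]
    intro a ha ham b hb hbm hab
    exact hcon ⟨i, j, k, hij, hik, hjk, _, (hN (hA a ha)).2, _, (hN (hB b hb)).2, _, (hN hm).2,
      disjoint_maskSet hx hab, disjoint_maskSet hx ham, disjoint_maskSet hx hbm⟩
  have h0 : ∀ m ∈ [3, 12, 48], m ∈ N 0 := by
    intro m hm
    simp only [N, mem_filter, List.mem_toFinset]
    refine ⟨?_, hx0 m hm⟩
    revert m
    decide
  obtain ⟨p, hp, q, hq, r, hr, hpq, hqr⟩ :=
    exists_lt_lt_of_three_le_card ((h3 1 (by decide)).trans (hMN 1))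
  obtain ⟨a, ha, b, hb, c, hc, hab, hbc⟩ :=
    exists_lt_lt_of_three_le_card ((h3 2 (by decide)).trans (hMN 2))
  obtain ⟨m, hm, n, hn, hmn⟩ := exists_lt_of_two_le_card (h3'.trans (hMN 3))
  have hB : ∀ z ∈ [r, p, q], z ∈ N 1 := by simp [hp, hq, hr]
  have hC : ∀ z ∈ [c, a, b], z ∈ N 2 := by simp [ha, hb, hc]
  have hall : ∀ {i j : Fin 4} {A : List ℕ} {z : ℕ}, i ≠ j → (∀ a ∈ A, a ∈ N i) → z ∈ N j →
      (A.all fun a => a != z) = true := fun hij hA hz =>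
    List.all_eq_true.2 fun a ha => hdiff hij (hA a ha) hz
  have key := rainbow_masks [r, p, q]
    (mem_matchingsThree (List.mem_filter.2 ⟨(hN hp).1, hall (by decide) h0 hp⟩)
      (List.mem_filter.2 ⟨(hN hq).1, hall (by decide) h0 hq⟩)
      (List.mem_filter.2 ⟨(hN hr).1, hall (by decide) h0 hr⟩) hpq hqr (hland hp hq hpq)
      (hland hp hr (hpq.trans hqr)) (hland hq hr hqr))
  have hmem2 : ∀ z ∈ N 2, z ∈ edgeMasks.filter fun m =>
      ([3, 12, 48].all fun a => a != m) && ([r, p, q].all fun b => b != m) &&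
        noRainbow [3, 12, 48] [r, p, q] m := by
    intro z hz
    rw [List.mem_filter, hall (by decide) h0 hz, hall (by decide) hB hz,
      hfree (by decide) (by decide) (by decide) h0 hB hz]
    exact ⟨(hN hz).1, rfl⟩
  have key2 := key [c, a, b]
    (mem_matchingsThree (hmem2 a ha) (hmem2 b hb) (hmem2 c hc) hab hbc (hland ha hb hab)
      (hland ha hc (hab.trans hbc)) (hland hb hc hbc))
  have hmem3 : ∀ z ∈ N 3, z ∈ edgeMasks.filter fun m => ([3, 12, 48].all fun a => a != m) &&
      ([r, p, q].all fun b => b != m) && ([c, a, b].all fun c => c != m) &&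
      noRainbow [3, 12, 48] [r, p, q] m && noRainbow [3, 12, 48] [c, a, b] m &&
      noRainbow [r, p, q] [c, a, b] m := by
    intro z hz
    rw [List.mem_filter, hall (by decide) h0 hz, hall (by decide) hB hz, hall (by decide) hC hz,
      hfree (by decide) (by decide) (by decide) h0 hB hz,
      hfree (by decide) (by decide) (by decide) h0 hC hz,
      hfree (by decide) (by decide) (by decide) hB hC hz]
    exact ⟨(hN hz).1, rfl⟩
  have := mem_matchingsTwo (hmem3 m hm) (hmem3 n hn) hmn (hland hm hn hmn)
  rw [key2] at this
  exact absurd this List.not_mem_nil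

end PartitionCover

/-! ### The seven remaining points and the final contradiction -/

namespace PartitionCover

open Finset

variable {X β : Type*} [DecidableEq X] [DecidableEq β] {ℓ : Fin 7 → X → β}

/-- The points of `E` in the class of `r` on side `s`. -/
def mates (ℓ : Fin 7 → X → β) (E : Finset X) (r : X) (s : Fin 7) : Finset X :=
  {e ∈ E | ℓ s e = ℓ s r}

/-- The sides on which `r` shares its class with a point of `E`. -/
def contactSides (ℓ : Fin 7 → X → β) (E : Finset X) (r : X) : Finset (Fin 7) :=
  {s | ℓ s r ∈ E.image (ℓ s)}

lemma isBlock_insert_mates (E : Finset X) (r : X) (s : Fin 7) :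
    IsBlock ℓ (insert r (mates ℓ E r s)) :=
  ⟨s, ℓ s r, by simp [mates]⟩

/-- The mates of `r` over its contact sides exhaust `E`, because `r` shares a class with every
point; few contact sides therefore force many disjoint pairs. -/
lemma exists_disjoint_mates (hℓ : ∀ x y, ∃ s, ℓ s x = ℓ s y) {E : Finset X}
    (hE : ∀ s v, #{e ∈ E | ℓ s e = v} ≤ 2) (r : X) :
    ∃ I : Finset (Fin 7), (∀ s ∈ I, #(mates ℓ E r s) = 2) ∧
      (I : Set (Fin 7)).PairwiseDisjoint (mates ℓ E r) ∧
      #E ≤ #I + #(contactSides ℓ E r) ∧ #I ≤ #(contactSides ℓ E r) := by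
  obtain ⟨I, hI, h2, hd, hc⟩ := exists_disjoint_pairs (mates ℓ E r) (contactSides ℓ E r)
    fun s _ => hE s _
  refine ⟨I, h2, hd, (card_le_card fun e he => ?_).trans hc, card_le_card hI⟩
  obtain ⟨s, hs⟩ := hℓ e r
  simp only [mem_biUnion, contactSides, mates, mem_filter, mem_univ, true_and]
  exact ⟨s, hs ▸ mem_image_of_mem _ he, he, hs⟩

variable [Fintype X]

/-- Counted by sides: a general side has at most 6 contacts, the side of `F` at most 3 and that of
`D` at most 4, and `3 + 4 + 5 * 6 = 37`. If both blocks lie on one side, that side has none. -/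
lemma contact_sum_le (hℓ : ∀ x y, ∃ s, ℓ s x = ℓ s y) (hX : Fintype.card X = 16)
    (hN : ¬ Cov ℓ 5 univ) {F D : Finset X} (hF : IsBlock ℓ F) (hD : IsBlock ℓ D)
    (hFD : Disjoint F D) (hF5 : #F = 5) (hD4 : #D = 4)
    (himg : ∀ s, #((univ \ (F ∪ D)).image (ℓ s)) = 4) :
    ∑ r ∈ F ∪ D, #(contactSides ℓ (univ \ (F ∪ D)) r) ≤ 37 := by
  set E := univ \ (F ∪ D) with hE
  have hEF : ∀ e ∈ E, e ∉ F := fun e he h => (mem_sdiff.1 he).2 (mem_union_left _ h)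
  have hED : ∀ e ∈ E, e ∉ D := fun e he h => (mem_sdiff.1 he).2 (mem_union_right _ h)
  have hE7 : #E = 7 := by
    have := card_sdiff_add_card_eq_card (subset_univ (F ∪ D))
    rw [← hE, card_union_of_disjoint hFD, card_univ, hX] at this
    omega
  let att : Fin 7 → Finset X := fun s => {r ∈ F ∪ D | ℓ s r ∈ E.image (ℓ s)}
  have hsum : ∑ r ∈ F ∪ D, #(contactSides ℓ E r) = ∑ s, #(att s) := by
    simp only [contactSides, att, card_filter]
    rw [sum_comm]
  have h6 : ∀ s, #(att s) ≤ 6 := by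
    intro s
    -- The four classes meeting `E`, together with one pair, do not cover, so they hold at most 13
    -- points, seven of them in `E`.
    have h1 := sum_fibers_lt_of_not_cov hℓ 1 hN s (E.image (ℓ s)) (by rw [himg])
    rw [← card_filter_mem, card_univ, hX] at h1
    have h2 : E ∪ att s ⊆ ({x | ℓ s x ∈ E.image (ℓ s)} : Finset X) := by
      refine union_subset (fun e he => ?_) fun r hr => ?_
      · simpa using ⟨e, he, rfl⟩
      · simpa using (mem_filter.1 hr).2
    have h3 := card_le_card h2
    have h4 : Disjoint E (att s) := sdiff_disjoint.mono_right (filter_subset _ _)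
    rw [card_union_of_disjoint h4] at h3
    omega
  have hcover : ∀ s v, ∃ x, ℓ s x ≠ v ∧ ℓ s x ∉ E.image (ℓ s) := by
    intro s v
    by_contra hcon
    push Not at hcon
    refine hN ((cov_of_image s (insert v (E.image (ℓ s))) fun x _ => ?_).mono
      ((card_insert_le _ _).trans (by rw [himg])) Subset.rfl)
    rw [mem_insert]
    exact or_iff_not_imp_left.2 (hcon x)
  obtain ⟨s, v, hs⟩ := hF
  obtain ⟨t, w, ht⟩ := hD
  -- A point of `E` in the class of `F` would make a block of size six; in the class of `D`, below,
  -- a second 5-block disjoint from `F`.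
  have hattF : att s ⊆ D := by
    intro r hr
    obtain ⟨hr, hre⟩ := mem_filter.1 hr
    refine (mem_union.1 hr).resolve_left fun hrF => ?_
    obtain ⟨e, he, hre⟩ := mem_image.1 hre
    have hb : IsBlock ℓ (insert e F) := ⟨s, v, by simpa [hre, hs r hrF] using hs⟩
    have := hb.card_le_five hℓ hX hN
    rw [card_insert_of_notMem (hEF e he)] at this
    omega
  have hattD : att t ⊆ F := by
    intro r hr
    obtain ⟨hr, hre⟩ := mem_filter.1 hr
    refine (mem_union.1 hr).resolve_right fun hrD => ?_
    obtain ⟨e, he, hre⟩ := mem_image.1 hre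
    have hb : IsBlock ℓ (insert e D) := ⟨t, w, by simpa [hre, ht r hrD] using ht⟩
    have := no_five_five hℓ hX hN ⟨s, v, hs⟩ hb
      (disjoint_insert_right.2 ⟨hEF e he, hFD⟩) hF5
    rw [card_insert_of_notMem (hED e he)] at this
    omega
  have hmem : ∀ x s, ℓ s x ∉ E.image (ℓ s) → x ∈ F ∪ D := by
    intro x s hx
    by_contra h
    exact hx (mem_image_of_mem _ (mem_sdiff.2 ⟨mem_univ _, h⟩))
  have h3 : #(att s) ≤ 3 := by
    obtain ⟨x, hxv, hx⟩ := hcover s v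
    have hxD : x ∈ D := (mem_union.1 (hmem x s hx)).resolve_left fun h => hxv (hs x h)
    have hxa : x ∉ att s := fun h => hx (mem_filter.1 h).2
    have := card_lt_card ((ssubset_iff_of_subset hattF).2 ⟨x, hxD, hxa⟩)
    omega
  have h4 : #(att t) ≤ 4 := by
    obtain ⟨x, hxv, hx⟩ := hcover t w
    have hxF : x ∈ F := (mem_union.1 (hmem x t hx)).resolve_right fun h => hxv (ht x h)
    have hxa : x ∉ att t := fun h => hx (mem_filter.1 h).2
    have := card_lt_card ((ssubset_iff_of_subset hattD).2 ⟨x, hxF, hxa⟩)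
    omega
  rw [hsum, ← add_sum_erase _ _ (mem_univ s)]
  by_cases hst : t = s
  · subst hst
    have h0 : att t = ∅ := subset_empty.1 ((disjoint_iff_inter_eq_empty.1 hFD) ▸
      subset_inter hattD hattF)
    have := sum_le_card_nsmul (univ.erase t) (fun s => #(att s)) 6 fun s _ => h6 s
    rw [card_erase_of_mem (mem_univ _), card_univ, Fintype.card_fin, smul_eq_mul] at this
    rw [h0, card_empty]
    omega
  · have ht' : t ∈ univ.erase s := mem_erase.2 ⟨hst, mem_univ _⟩
    rw [← add_sum_erase _ _ ht']
    have := sum_le_card_nsmul ((univ.erase s).erase t) (fun s => #(att s)) 6 fun s _ => h6 s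
    rw [card_erase_of_mem ht', card_erase_of_mem (mem_univ _), card_univ, Fintype.card_fin,
      smul_eq_mul] at this
    omega

/-- The four points of a `4`-set, listed so that a function with small sum is small on them. -/
lemma exists_enumeration {D : Finset X} (hD : #D = 4) (a : X → ℕ) (h4 : ∀ x, 4 ≤ a x)
    (hsum : ∑ x ∈ D, a x ≤ 17) :
    ∃ d : Fin 4 → X, Function.Injective d ∧ (∀ i, d i ∈ D) ∧ (∀ i, i ≠ 3 → a (d i) ≤ 4) ∧
      a (d 3) ≤ 5 := by
  obtain ⟨m, hm, hmax⟩ := exists_max_image D a (card_pos.1 (by omega))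
  have h3 : #(D.erase m) = 3 := by rw [card_erase_of_mem hm, hD]
  obtain ⟨x, y, z, hxy, hxz, hyz, he⟩ := card_eq_three.1 h3
  have hx : x ∈ D.erase m := by simp [he]
  have hy : y ∈ D.erase m := by simp [he]
  have hz : z ∈ D.erase m := by simp [he]
  rw [← add_sum_erase _ _ hm, he, sum_insert (by simp [hxy, hxz]), sum_pair hyz] at hsum
  rw [mem_erase] at hx hy hz
  have := h4 x
  have := h4 y
  have := h4 z
  have := h4 m
  have := hmax x hx.2
  have := hmax y hy.2
  have := hmax z hz.2
  refine ⟨![x, y, z, m], ?_, ?_, ?_, ?_⟩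
  · intro i j hij
    fin_cases i <;> fin_cases j <;> simp_all
  · intro i
    fin_cases i <;> simp [hx.2, hy.2, hz.2, hm]
  · intro i hi
    fin_cases i <;> simp <;> first | omega | exact absurd rfl hi
  · simp
    omega

lemma exists_cov_five (hℓ : ∀ x y, ∃ s, ℓ s x = ℓ s y) (hX : Fintype.card X = 16) :
    Cov ℓ 5 univ := by
  by_contra hN
  obtain ⟨F, D, hF, hD, hFD, hF5, hD4⟩ := exists_disjoint_five_four hℓ hX hN
  set E := univ \ (F ∪ D) with hE
  have hFE : Disjoint F E := disjoint_sdiff.mono_left subset_union_left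
  have hDE : Disjoint D E := disjoint_sdiff.mono_left subset_union_right
  have hE7 : #E = 7 := by
    have := card_sdiff_add_card_eq_card (subset_univ (F ∪ D))
    rw [← hE, card_union_of_disjoint hFD, card_univ, hX] at this
    omega
  have hfib : ∀ s v, #{e ∈ E | ℓ s e = v} ≤ 2 := fun s v =>
    Nat.le_of_lt_succ (no_five_four_three hℓ hX hN hF hD ⟨s, v, by simp⟩ hFD
      (hFE.mono_right (filter_subset _ _)) (hDE.mono_right (filter_subset _ _)) hF5 hD4.ge)
  have hcounts : ∀ s, 7 = numClasses (ℓ s) E 1 + numClasses (ℓ s) E 2 ∧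
      #(samePairs (ℓ s) E) = 2 * numClasses (ℓ s) E 2 ∧ #(samePairs (ℓ s) E) ≤ 6 := by
    intro s
    have h5 : ∀ v, #{e ∈ E | ℓ s e = v} ≤ 5 := fun v => (hfib s v).trans (by norm_num)
    have a1 := card_eq_numClasses (ℓ s) E h5
    have a2 := card_samePairs_eq (ℓ s) E h5
    have a3 := numClasses_eq_zero (ℓ s) E (hfib s) (k := 3) (by norm_num)
    have a4 := numClasses_eq_zero (ℓ s) E (hfib s) (k := 4) (by norm_num)
    have a5 := numClasses_eq_zero (ℓ s) E (hfib s) (k := 5) (by norm_num)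
    have a6 := numClasses_anti (ℓ s) E (show 1 ≤ 2 by norm_num)
    omega
  have hlow := card_offDiag_le hℓ E
  rw [hE7] at hlow
  have hsum6 : ∑ _s : Fin 7, 6 = 42 := rfl
  have hupp := sum_le_sum fun s (_ : s ∈ (univ : Finset (Fin 7))) => (hcounts s).2.2
  -- The 42 ordered pairs of `E` need all seven sides at their maximum of 6.
  have hall := (sum_eq_sum_iff_of_le fun s (_ : s ∈ (univ : Finset (Fin 7))) =>
    (hcounts s).2.2).1 (by omega)
  have himg : ∀ s, #(E.image (ℓ s)) = 4 := by
    intro s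
    have b1 := hcounts s
    have b2 := hall s (mem_univ s)
    rw [← numClasses_one]
    omega
  have huniq : ∀ x ∈ E, ∀ y ∈ E, x ≠ y → ∀ s t, ℓ s x = ℓ s y → ℓ t x = ℓ t y → s = t := by
    intro x hx y hy hxy s t hs ht
    refine side_unique_of_sum_le (ℓ := ℓ) (P := E.offDiag) (p := (x, y)) (fun p _ => hℓ _ _) ?_
      (mem_offDiag.2 ⟨hx, hy, hxy⟩) hs ht
    rw [offDiag_card, hE7]
    exact hupp
  have h37 := contact_sum_le hℓ hX hN hF hD hFD hF5 hD4 himg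
  rw [← hE, sum_union hFD] at h37
  choose I hI2 hId hIc hIc' using fun r => exists_disjoint_mates hℓ hfib r
  have h4 : ∀ r, 4 ≤ #(contactSides ℓ E r) := by
    intro r
    have := hIc r
    have := hIc' r
    omega
  have h20 := card_nsmul_le_sum F (fun r => #(contactSides ℓ E r)) 4 fun r _ => h4 r
  rw [hF5, smul_eq_mul] at h20
  -- The five points of `F` take at least 20 of the 37 contacts, leaving at most 17 for `D`.
  obtain ⟨d, hd, hdD, hd4, hd5⟩ := exists_enumeration hD4 (fun r => #(contactSides ℓ E r)) h4
    (by omega)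
  have hmE : ∀ r s, mates ℓ E r s ⊆ E := fun r s => filter_subset _ _
  have hdE : ∀ i, d i ∉ E := fun i => disjoint_left.1 hDE (hdD i)
  have hdF : ∀ i, d i ∉ F := fun i => disjoint_right.1 hFD (hdD i)
  have hI3 : ∀ i, i ≠ 3 → 3 ≤ #(I (d i)) := by
    intro i hi
    have := hIc (d i)
    have := hd4 i hi
    omega
  let M : Fin 4 → Finset (Finset X) := fun i => (I (d i)).image (mates ℓ E (d i))
  have hMc : ∀ i, #(M i) = #(I (d i)) := by
    intro i
    refine card_image_of_injOn fun s hs t ht hst => ?_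
    by_contra hne
    have a := hId (d i) hs ht hne
    have b := hI2 (d i) t ht
    rw [Function.onFun, hst, disjoint_self_iff_empty] at a
    rw [a] at b
    simp at b
  have hblock : ∀ {i A}, A ∈ M i → IsBlock ℓ (insert (d i) A) ∧ #(insert (d i) A) = 3 ∧
      Disjoint F (insert (d i) A) ∧ A ⊆ E := by
    intro i A hA
    obtain ⟨s, hs, rfl⟩ := mem_image.1 hA
    refine ⟨isBlock_insert_mates _ _ _, ?_, ?_, hmE _ _⟩
    · rw [card_insert_of_notMem fun h => hdE i (hmE _ _ h), hI2 _ s hs]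
    · exact disjoint_insert_right.2 ⟨hdF i, hFE.mono_right (hmE _ _)⟩
  have hne : ∀ i j, i ≠ j → Disjoint (M i) (M j) := by
    intro i j hij
    rw [disjoint_left]
    intro B hBi hBj
    obtain ⟨s, hs, rfl⟩ := mem_image.1 hBi
    obtain ⟨t, ht, hts⟩ := mem_image.1 hBj
    set B := mates ℓ E (d i) s with hB
    have hB2 : #B = 2 := hI2 _ s hs
    have hBs : ∀ e ∈ B, ℓ s e = ℓ s (d i) := fun e he => (mem_filter.1 he).2
    have hBt : ∀ e ∈ B, ℓ t e = ℓ t (d j) := fun e he => by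
      rw [← hts] at he
      exact (mem_filter.1 he).2
    obtain ⟨e, he, e', he', hee⟩ := one_lt_card.1 (show 1 < #B by omega)
    obtain rfl : s = t := huniq e (hmE _ _ he) e' (hmE _ _ he') hee s t
      ((hBs e he).trans (hBs e' he').symm) ((hBt e he).trans (hBt e' he').symm)
    have hb4 : IsBlock ℓ ({d i, d j} ∪ B) := by
      refine ⟨s, ℓ s (d i), fun x hx => ?_⟩
      simp only [mem_union, mem_insert, mem_singleton] at hx
      rcases hx with (rfl | rfl) | hx
      · rfl
      · rw [← hBt e he, hBs e he]
      · exact hBs x hx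
    have hdis : Disjoint {d i, d j} B := by
      rw [disjoint_insert_left, disjoint_singleton_left]
      exact ⟨fun h => hdE i (hmE _ _ h), fun h => hdE j (hmE _ _ h)⟩
    have hb4c : #({d i, d j} ∪ B) = 4 := by
      rw [card_union_of_disjoint hdis, card_pair (hd.ne hij), hB2]
    -- A third point with three disjoint pairs is needed (hence `k ≠ 3`): one of them misses the
    -- two-point set `B` and completes blocks 5,4,3.
    obtain ⟨k, hk3, hki, hkj⟩ : ∃ k : Fin 4, k ≠ 3 ∧ k ≠ i ∧ k ≠ j :=
      (by decide : ∀ i j : Fin 4, ∃ k : Fin 4, k ≠ 3 ∧ k ≠ i ∧ k ≠ j) i j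
    obtain ⟨r, hr, hrB⟩ : ∃ r ∈ I (d k), Disjoint (mates ℓ E (d k) r) B := by
      by_contra hcon
      push Not at hcon
      have c1 : #((I (d k)).biUnion fun r => mates ℓ E (d k) r ∩ B) ≤ #B :=
        card_le_card (biUnion_subset.2 fun r _ => inter_subset_right)
      rw [card_biUnion fun r hr r' hr' hrr => (hId (d k) hr hr' hrr).mono inter_subset_left
        inter_subset_left] at c1
      have c2 := card_nsmul_le_sum (I (d k)) (fun r => #(mates ℓ E (d k) r ∩ B)) 1 fun r hr =>
        card_pos.2 (not_disjoint_iff_nonempty_inter.1 (hcon r hr))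
      have := hI3 k hk3
      rw [smul_eq_mul] at c2
      omega
    obtain ⟨b1, b2, b3, b4⟩ := hblock (i := k) (mem_image_of_mem _ hr)
    have := no_five_four_three hℓ hX hN hF hb4 b1 ?_ b3 ?_ hF5 hb4c.ge
    · omega
    · rw [disjoint_union_right, disjoint_insert_right, disjoint_singleton_right]
      exact ⟨⟨hdF i, hdF j⟩, hFE.mono_right (hmE _ _)⟩
    · rw [disjoint_insert_right, mem_union, mem_insert, mem_singleton, disjoint_union_left,
        disjoint_insert_left, disjoint_singleton_left]
      exact ⟨by simpa [hd.eq_iff, hki, hkj] using fun h => hdE k (hmE _ _ h),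
        ⟨fun h => hdE i (b4 h), fun h => hdE j (b4 h)⟩, hrB.symm⟩
  obtain ⟨i, j, k, hij, hik, hjk, A, hA, B, hB, C, hC, hAB, hAC, hBC⟩ := exists_rainbow hE7 M
    (fun i A hA => by
      obtain ⟨s, hs, rfl⟩ := mem_image.1 hA
      exact ⟨hmE _ _, hI2 _ s hs⟩)
    (fun i A hA B hB hAB => by
      obtain ⟨s, hs, rfl⟩ := mem_image.1 (mem_coe.1 hA)
      obtain ⟨t, ht, rfl⟩ := mem_image.1 (mem_coe.1 hB)
      exact hId (d i) hs ht fun e => hAB (by rw [e]))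
    hne (fun i hi => by rw [hMc]; exact hI3 i hi)
    (by
      have := hIc (d 3)
      rw [hMc]
      omega)
  have hdisj : ∀ {i j A B}, i ≠ j → A ∈ M i → B ∈ M j → Disjoint A B →
      Disjoint (insert (d i) A) (insert (d j) B) := by
    intro i j A B hij hA hB hAB
    have hAE := (hblock hA).2.2.2
    have hBE := (hblock hB).2.2.2
    rw [disjoint_insert_left, disjoint_insert_right, mem_insert]
    exact ⟨by simpa [hd.eq_iff, hij] using fun h => hdE i (hBE h), fun h => hdE j (hAE h), hAB⟩
  have hlt := no_five_three_three_three hℓ hX hN hF (hblock hA).1 (hblock hB).1 (hblock hC).1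
    (hblock hA).2.2.1 (hblock hB).2.2.1 (hblock hC).2.2.1 (hdisj hij hA hB hAB)
    (hdisj hik hA hC hAC) (hdisj hjk hB hC hBC) hF5 (hblock hA).2.1.ge (hblock hB).2.1.ge
  have := (hblock hC).2.1
  omega

end PartitionCover

/-! ### Lower bound for hypergraphs -/

namespace Hypergraph

variable {α : Type u} {H : Hypergraph α}

lemma IsIntersecting.inter_nonempty (hH : H.IsIntersecting) {e f : Set α} (he : e ∈ E(H))
    (hf : f ∈ E(H)) (hne : e ≠ f) : (e ∩ f).Nonempty := by
  rw [← Set.not_disjoint_iff_nonempty_inter]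
  intro hd
  have hM : H.IsMatching {e, f} := by
    refine ⟨Set.insert_subset he (Set.singleton_subset_iff.2 hf), ?_⟩
    rw [Set.pairwise_pair]
    exact fun _ => ⟨hd, hd.symm⟩
  have h2 : ({e, f} : Set (Set α)).encard ≤ H.matchingNumber :=
    le_iSup₂ (f := fun (M : Set (Set α)) (_ : H.IsMatching M) => M.encard) _ hM
  rw [Set.encard_pair hne, hH] at h2
  exact absurd h2 (by norm_num)

lemma IsIntersecting.edgeSet_nonempty (hH : H.IsIntersecting) : E(H).Nonempty := by
  rw [Set.nonempty_iff_ne_empty]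
  intro h
  have : H.matchingNumber ≤ 0 := iSup₂_le fun M hM => by
    have hM0 : M ⊆ ∅ := h ▸ hM.1
    simp [Set.subset_empty_iff.1 hM0]
  rw [hH] at this
  simp at this

lemma coveringNumber_le {C : Set α} (hC : H.IsCover C) : H.coveringNumber ≤ C.encard :=
  iInf₂_le (f := fun (C : Set α) (_ : H.IsCover C) => C.encard) C hC

lemma coveringNumber_le_card (C : Finset α) (hC : ∀ e ∈ E(H), ∃ x ∈ C, x ∈ e) :
    H.coveringNumber ≤ C.card := by
  have h : H.IsCover (C ∩ V(H)) := ⟨Set.inter_subset_right, fun e he =>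
    let ⟨x, hx, hxe⟩ := hC e he
    ⟨x, ⟨hx, H.subset_vertexSet_of_mem_edgeSet he hxe⟩, hxe⟩⟩
  refine (coveringNumber_le h).trans ?_
  rw [← Set.encard_coe_eq_coe_finsetCard]
  exact Set.encard_le_encard Set.inter_subset_left

lemma exists_surjection_of_card_le {β : Type*} {S : Set β} {k n : ℕ} (hS : S.encard = k)
    (hne : S.Nonempty) (hk : k ≤ n) : ∃ f : Fin n → β, Set.range f = S := by
  have hfin : S.Finite := Set.finite_of_encard_eq_coe hS
  have hc : hfin.toFinset.card = k := by
    rw [hfin.encard_eq_coe_toFinset_card] at hS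
    exact_mod_cast hS
  obtain ⟨b, hb⟩ := hne
  let g := hfin.toFinset.equivFinOfCardEq hc
  refine ⟨fun i => if h : i.1 < k then (g.symm ⟨i, h⟩ : β) else b, Set.Subset.antisymm ?_ ?_⟩
  · rintro _ ⟨i, rfl⟩
    dsimp only
    split_ifs with h
    · exact hfin.mem_toFinset.1 (g.symm ⟨i, h⟩).2
    · exact hb
  · intro x hx
    let y := g ⟨x, hfin.mem_toFinset.2 hx⟩
    refine ⟨⟨y, y.2.trans_le hk⟩, ?_⟩
    simp [y]

theorem IsPartite.coveringNumber_le_five (hp : H.IsPartite 7) (hi : H.IsIntersecting) {k : ℕ}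
    (hk : E(H).encard = k) (h16 : k ≤ 16) : H.coveringNumber ≤ 5 := by
  classical
  obtain ⟨side, -, hV, hside⟩ := hp
  -- Repeating edges reduces every case to exactly 16 points; repeated edges agree on every side.
  obtain ⟨f, hf⟩ := exists_surjection_of_card_le hk hi.edgeSet_nonempty h16
  have hfE : ∀ i, f i ∈ E(H) := fun i => hf ▸ Set.mem_range_self i
  choose v hv hv' using fun (s : Fin 7) (i : Fin 16) => hside (f i) (hfE i) s
  have hagree : ∀ i j, ∃ s, v s i = v s j := by
    intro i j
    by_cases hij : f i = f j
    · refine ⟨0, hv' 0 j _ ?_⟩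
      have := hv 0 i
      dsimp only at this
      rwa [hij] at this
    · obtain ⟨x, hx, hxj⟩ := hi.inter_nonempty (hfE i) (hfE j) hij
      obtain ⟨s, hs⟩ := Set.mem_iUnion.1 (hV.symm ▸ H.subset_vertexSet_of_mem_edgeSet (hfE i) hx)
      exact ⟨s, (hv' s i x ⟨hx, hs⟩).symm.trans (hv' s j x ⟨hxj, hs⟩)⟩
  obtain ⟨c, hc, hcov⟩ := PartitionCover.exists_cov_five hagree (by simp)
  refine (coveringNumber_le_card (c.image Prod.snd) fun e he => ?_).trans ?_
  · obtain ⟨i, rfl⟩ := hf.symm ▸ he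
    obtain ⟨p, hp, hpe⟩ := hcov i (Finset.mem_univ i)
    exact ⟨p.2, Finset.mem_image_of_mem _ hp, hpe ▸ (hv p.1 i).1⟩
  · exact_mod_cast Finset.card_image_le.trans hc

end Hypergraph

/-! ### The example with 17 edges -/

namespace Hypergraph

variable {α : Type u}

lemma tightRows_bounds : ∀ (j : Fin 17) (i : Fin 7), 1 ≤ tightRows j i ∧ tightRows j i ≤ 6 := by
  decide

lemma tightRows_agree : ∀ j k : Fin 17, ∃ i, tightRows j i = tightRows k i := by
  decide +kernel

lemma tightRows_injective : ∀ j k : Fin 17, (∀ i, tightRows j i = tightRows k i) → j = k := by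
  decide +kernel

/-- The copy of `tightHypergraph` along an embedding of its vertices. -/
def tightCopy (g : Fin 7 × ℕ ↪ α) : Hypergraph α where
  vertexSet := g '' {v | 1 ≤ v.2 ∧ v.2 ≤ 6}
  edgeSet := Set.range fun j : Fin 17 => Set.range fun i : Fin 7 => g (i, tightRows j i)
  subset_vertexSet_of_mem_edgeSet' := by
    rintro _ ⟨j, rfl⟩ _ ⟨i, rfl⟩
    exact Set.mem_image_of_mem g (tightRows_bounds j i)

lemma tightCopy_refl : tightCopy (Function.Embedding.refl _) = tightHypergraph := by
  ext <;> simp [tightCopy, tightHypergraph]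

lemma tightCopy_isPartite (g : Fin 7 × ℕ ↪ α) : (tightCopy g).IsPartite 7 := by
  refine ⟨fun i => g '' {v | v.1 = i ∧ 1 ≤ v.2 ∧ v.2 ≤ 6}, ?_, ?_, ?_⟩
  · intro i j hij
    rw [Set.disjoint_image_iff g.injective, Set.disjoint_left]
    exact fun v hv hv' => hij (hv.1.symm.trans hv'.1)
  · rw [← Set.image_iUnion]
    refine congrArg (g '' ·) (Set.ext fun v => ?_)
    simp
  · rintro _ ⟨j, rfl⟩ i
    refine ⟨g (i, tightRows j i), ⟨⟨i, rfl⟩, Set.mem_image_of_mem g ⟨rfl, tightRows_bounds j i⟩⟩, ?_⟩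
    rintro _ ⟨⟨i', rfl⟩, v, hv, hvi⟩
    have := g.injective hvi
    subst this
    obtain rfl : i' = i := hv.1
    rfl

lemma tightCopy_matchingNumber (g : Fin 7 × ℕ ↪ α) : (tightCopy g).matchingNumber = 1 := by
  refine le_antisymm (iSup₂_le fun M hM => ?_) ?_
  · rw [Set.encard_le_one_iff]
    intro e f he hf
    by_contra hne
    have hd := hM.2 he hf hne
    obtain ⟨j, rfl⟩ := hM.1 he
    obtain ⟨k, rfl⟩ := hM.1 hf
    obtain ⟨i, hi⟩ := tightRows_agree j k
    exact Set.disjoint_left.1 hd ⟨i, rfl⟩ ⟨i, by simp [hi]⟩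
  · have hM : (tightCopy g).IsMatching {Set.range fun i : Fin 7 => g (i, tightRows 0 i)} :=
      ⟨Set.singleton_subset_iff.2 ⟨0, rfl⟩, Set.pairwise_singleton _ _⟩
    have := le_iSup₂ (f := fun (M : Set (Set α)) (_ : (tightCopy g).IsMatching M) => M.encard) _ hM
    rwa [Set.encard_singleton] at this

lemma tightCopy_encard_edgeSet (g : Fin 7 × ℕ ↪ α) : E(tightCopy g).encard = 17 := by
  have hinj : Function.Injective fun j : Fin 17 =>
      Set.range fun i : Fin 7 => g (i, tightRows j i) := by
    intro j k hjk
    refine tightRows_injective j k fun i => ?_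
    have h : g (i, tightRows j i) ∈ Set.range fun i : Fin 7 => g (i, tightRows k i) := by
      rw [← show _ = Set.range fun i : Fin 7 => g (i, tightRows k i) from hjk]
      exact ⟨i, rfl⟩
    obtain ⟨i', hi'⟩ := h
    have := g.injective hi'
    simp only [Prod.mk.injEq] at this
    obtain ⟨rfl, h⟩ := this
    exact h.symm
  change (Set.range _).encard = 17
  rw [← Set.image_univ, hinj.encard_image, Set.encard_univ]
  simp

/-- Exhaustive search for a set of `n` vertices that meets all the rows in the list. -/
def rowsCoverable : ℕ → List (Fin 17) → Bool
  | _, [] => true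
  | 0, _ :: _ => false
  | n + 1, j :: L => (List.finRange 7).any fun i =>
      rowsCoverable n (L.filter fun k => !(tightRows k i == tightRows j i))

/-- A cover contains a vertex of the first remaining row, so branching over the seven vertices of
that row loses no cover. -/
lemma rowsCoverable_of_cover (n : ℕ) (L : List (Fin 17)) (C : Finset (Fin 7 × ℕ)) (hC : C.card ≤ n)
    (h : ∀ k ∈ L, ∃ i, (i, tightRows k i) ∈ C) : rowsCoverable n L = true := by
  induction n generalizing L C with
  | zero =>
    obtain rfl : C = ∅ := by simpa using hC
    cases L with
    | nil => rfl
    | cons j L => simpa using h j (by simp)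
  | succ n ih =>
    cases L with
    | nil => rfl
    | cons j L =>
      obtain ⟨i, hi⟩ := h j (by simp)
      rw [rowsCoverable, List.any_eq_true]
      refine ⟨i, List.mem_finRange i, ih _ (C.erase (i, tightRows j i)) ?_ fun k hk => ?_⟩
      · rw [Finset.card_erase_of_mem hi]
        omega
      · rw [List.mem_filter] at hk
        obtain ⟨i', hi'⟩ := h k (List.mem_cons_of_mem _ hk.1)
        refine ⟨i', Finset.mem_erase.2 ⟨fun e => ?_, hi'⟩⟩
        simp only [Prod.mk.injEq] at e
        obtain ⟨rfl, e⟩ := e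
        simp [e] at hk

lemma rowsCoverable_five : rowsCoverable 5 (List.finRange 17) = false := by
  decide +kernel

lemma tightCopy_coveringNumber (g : Fin 7 × ℕ ↪ α) : (tightCopy g).coveringNumber = 6 := by
  classical
  refine le_antisymm ?_ (le_iInf₂ fun C hC => ?_)
  · refine (coveringNumber_le_card ((Finset.Icc 1 6).image fun a => g (0, a)) ?_).trans ?_
    · rintro _ ⟨j, rfl⟩
      exact ⟨g (0, tightRows j 0), Finset.mem_image_of_mem (fun a => g (0, a))
        (Finset.mem_Icc.2 (tightRows_bounds j 0)), 0, rfl⟩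
    · exact_mod_cast Finset.card_image_le.trans (by simp)
  · by_contra hlt
    have h5 : C.encard ≤ 5 := 
      Order.le_of_lt_add_one ((not_le.1 hlt).trans_eq (by norm_num))
    have hfin : C.Finite := Set.finite_of_encard_le_coe (k := 5) (by exact_mod_cast h5)
    rw [hfin.encard_eq_coe_toFinset_card] at h5
    have h5' : hfin.toFinset.card ≤ 5 := by exact_mod_cast h5
    have := rowsCoverable_of_cover 5 (List.finRange 17)
      (hfin.toFinset.preimage g g.injective.injOn)
      ((Finset.card_le_card_of_injOn g (by simp [Set.MapsTo]) g.injective.injOn).trans h5') fun k _ => by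
        obtain ⟨_, hx, i, rfl⟩ := hC.2 _ ⟨k, rfl⟩
        exact ⟨i, by simpa using hx⟩
    rw [rowsCoverable_five] at this
    exact absurd this (by simp)

end Hypergraph

theorem mainTheorem1 :
    IsLeast {k : ℕ | ∃ (α : Type u) (H : Hypergraph α),
      H.IsPartite 7 ∧ H.IsIntersecting ∧ 6 ≤ H.coveringNumber ∧ E(H).encard = k} 17 ∧
    (tightHypergraph.IsPartite 7 ∧ tightHypergraph.IsIntersecting ∧
      E(tightHypergraph).encard = 17 ∧ tightHypergraph.coveringNumber = 6 ∧
      tightHypergraph.coveringNumber = (7 - 1) * tightHypergraph.matchingNumber) := by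
  refine ⟨⟨?_, ?_⟩, ?_⟩
  · let g : Fin 7 × ℕ ↪ ULift.{u} (Fin 7 × ℕ) := ⟨ULift.up, ULift.up_injective⟩
    exact ⟨_, Hypergraph.tightCopy g, Hypergraph.tightCopy_isPartite g,
      Hypergraph.tightCopy_matchingNumber g, (Hypergraph.tightCopy_coveringNumber g).ge,
      Hypergraph.tightCopy_encard_edgeSet g⟩
  · rintro k ⟨α, H, hp, hi, h6, hk⟩
    by_contra hlt
    have h5 := h6.trans (hp.coveringNumber_le_five hi hk (by omega))
    exact absurd h5 (by norm_num)
  · rw [← Hypergraph.tightCopy_refl]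
    refine ⟨Hypergraph.tightCopy_isPartite _, Hypergraph.tightCopy_matchingNumber _,
      Hypergraph.tightCopy_encard_edgeSet _, Hypergraph.tightCopy_coveringNumber _, ?_⟩
    rw [Hypergraph.tightCopy_coveringNumber, Hypergraph.tightCopy_matchingNumber]
    rfl
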